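/- Theorem (pointwise inversion of the right- and left-sided quaternion Fourier transforms). Let $\mathbb H$ be the real quaternions with units $i,j,k$, let $(x_0,y_0)\in\mathbb R^2$ and $\varepsilon_1,\varepsilon_2>0$, and let $C=\{(s,t): |s-x_0|\le\varepsilon_1 \text{ or } |t-y_0|\le\varepsilon_2\}$ be the corresponding cross-neighborhood of $(x_0,y_0)$. Let $f=f_0+if_1+jf_2+kf_3\in L^1(\mathbb R^2,\mathbb H)$ satisfy the following two conditions. (QBVF) Each component $f_n$, $n=0,1,2,3$, is of bounded variation (in the sense of Hardy) in $C$, that is, on every compact rectangle $[a_1,b_1]\times[a_2,b_2]\subset C$ with $a_1<b_1$, $a_2<b_2$: the sums $\sum_{p<m}\sum_{q<n'}|g(s_{p+1},t_{q+1})-g(s_{p+1},t_q)-g(s_p,t_{q+1})+g(s_p,t_q)|$, with $g=f_n$, are bounded over all nets $a_1=s_0<\dots<s_m=b_1$, $a_2=t_0<\dots<t_{n'}=b_2$; $g(\sigma,\cdot)$ is of bounded variation on $[a_2,b_2]$ for at least one $\sigma\in[a_1,b_1]$; and $g(\cdot,\tau)$ is of bounded variation on $[a_1,b_1]$ for at least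 one $\tau\in[a_2,b_2]$. (LC) With $\tilde f(s,t)=f(x_0-s,y_0-t)+f(x_0+s,y_0+t)+f(x_0-s,y_0+t)+f(x_0+s,y_0-t)$, there are $a,b\in\mathbb R$ such that $\tilde f(a,\cdot)\in L^1(\mathbb R)$, $\tilde f(\cdot,b)\in L^1(\mathbb R)$, $$\int_{\varepsilon_2}^\infty\int_0^{\varepsilon_1}\left|\frac{\tilde f(s,t)-\tilde f(a,t)}{s}\right|ds\,dt<\infty\quad\text{and}\quad \int_{\varepsilon_1}^\infty\int_0^{\varepsilon_2}\left|\frac{\tilde f(s,t)-\tilde f(s,b)}{t}\right|dt\,ds<\infty .$$ Put $\mathcal F_R(u,v)=\int_{\mathbb R^2}f(s,t)e^{-ius}e^{-jvt}\,ds\,dt$ and $\mathcal F_L(u,v)=\int_{\mathbb R^2}e^{-ius}e^{-jvt}f(s,t)\,ds\,dt$. Then the four double limits $f(x_0\pm0,y_0\pm0)$ exist, as do those of each $f_n$, and with $$\eta(x_0,y_0)=\tfrac14\big(f(x_0+0,y_0+0)+f(x_0+0,y_0-0)+f(x_0-0,y_0+0)+f(x_0-0,y_0-0)\big)$$ one has,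 as $N\to\infty$ and $M\to\infty$ independently, (a) $\displaystyle \eta(x_0,y_0)=\lim_{N,M\to\infty}\frac1{4\pi^2}\int_{-N}^{N}\int_{-M}^{M}\mathcal F_R(u,v)e^{jvy_0}e^{iux_0}\,du\,dv$; (b) $\displaystyle \eta(x_0,y_0)=\lim_{N,M\to\infty}\frac1{4\pi^2}\int_{-N}^{N}\int_{-M}^{M}e^{jvy_0}e^{iux_0}\mathcal F_L(u,v)\,du\,dv$. Moreover $\eta=\eta_0+i\eta_1+j\eta_2+k\eta_3$ at $(x_0,y_0)$, where $\eta_n$ is the same mean of the four double limits of $f_n$; and if $f$ is continuous at $(x_0,y_0)$, then $\eta(x_0,y_0)=f(x_0,y_0)$. -/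

import Mathlib

open MeasureTheory Filter Topology
open scoped Quaternion

noncomputable section

namespace QFT

/-- The imaginary unit `i` of the quaternions. -/
def qi : ℍ := ⟨0, 1, 0, 0⟩

/-- The imaginary unit `j` of the quaternions. -/
def qj : ℍ := ⟨0, 0, 1, 0⟩

/-- The imaginary unit `k` of the quaternions. -/
def qk : ℍ := ⟨0, 0, 0, 1⟩

/-- The exponential `e^{iθ}` in the quaternions. -/
def expI (θ : ℝ) : ℍ := NormedSpace.exp (θ • qi)

/-- The exponential `e^{jθ}` in the quaternions. -/
def expJ (θ : ℝ) : ℍ := NormedSpace.exp (θ • qj)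

/-- The right-sided quaternion Fourier transform `∫ f(s,t) e^{-ius} e^{-jvt} ds dt`. -/
def rightQFT (f : ℝ × ℝ → ℍ) (u v : ℝ) : ℍ :=
  ∫ p : ℝ × ℝ, f p * expI (-(u * p.1)) * expJ (-(v * p.2))

/-- The left-sided quaternion Fourier transform `∫ e^{-ius} e^{-jvt} f(s,t) ds dt`. -/
def leftQFT (f : ℝ × ℝ → ℍ) (u v : ℝ) : ℍ :=
  ∫ p : ℝ × ℝ, expI (-(u * p.1)) * expJ (-(v * p.2)) * f p

/-- The truncated inversion integral of the right-sided transform at `(x₀, y₀)`: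
the variable `u` runs over `[-M, M]` and `v` over `[-N, N]`. -/
def rightInversion (f : ℝ × ℝ → ℍ) (x₀ y₀ N M : ℝ) : ℍ :=
  (1 / (4 * Real.pi ^ 2)) •
    ∫ v in (-N)..N, ∫ u in (-M)..M, rightQFT f u v * expJ (v * y₀) * expI (u * x₀)

/-- The truncated inversion integral of the left-sided transform at `(x₀, y₀)`:
the variable `u` runs over `[-M, M]` and `v` over `[-N, N]`. -/
def leftInversion (f : ℝ × ℝ → ℍ) (x₀ y₀ N M : ℝ) : ℍ :=
  (1 / (4 * Real.pi ^ 2)) •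
    ∫ v in (-N)..N, ∫ u in (-M)..M, expJ (v * y₀) * expI (u * x₀) * leftQFT f u v

/-- `s 0 < s 1 < ⋯ < s m` is a subdivision of `[a, b]`: `s 0 = a` and `s m = b`. -/
def IsSubdivision (a b : ℝ) (m : ℕ) (s : ℕ → ℝ) : Prop :=
  s 0 = a ∧ s m = b ∧ StrictMonoOn s (Set.Iic m)

/-- The mixed second difference of `g` over the rectangle with corners `(s, t)`, `(s', t')`. -/
def mixedDiff (g : ℝ × ℝ → ℝ) (s s' t t' : ℝ) : ℝ :=
  g (s', t') - g (s', t) - g (s, t') + g (s, t)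

/-- A real function is of bounded variation on the rectangle `[a₁, b₁] × [a₂, b₂]`
(in the sense of Hardy). -/
structure IsBVF (g : ℝ × ℝ → ℝ) (a₁ b₁ a₂ b₂ : ℝ) : Prop where
  bounded_nets : ∃ C : ℝ, ∀ (m n : ℕ) (s t : ℕ → ℝ),
    IsSubdivision a₁ b₁ m s → IsSubdivision a₂ b₂ n t →
      ∑ i ∈ Finset.range m, ∑ j ∈ Finset.range n,
        |mixedDiff g (s i) (s (i + 1)) (t j) (t (j + 1))| ≤ C
  section_fst : ∃ σ ∈ Set.Icc a₁ b₁, BoundedVariationOn (fun t => g (σ, t)) (Set.Icc a₂ b₂)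
  section_snd : ∃ τ ∈ Set.Icc a₂ b₂, BoundedVariationOn (fun s => g (s, τ)) (Set.Icc a₁ b₁)

/-- A real function is of bounded variation in a planar region `S` if it is so on every
(nondegenerate, compact, axis-parallel) rectangle contained in `S`. -/
def IsBVFIn (g : ℝ × ℝ → ℝ) (S : Set (ℝ × ℝ)) : Prop :=
  ∀ a₁ b₁ a₂ b₂ : ℝ, a₁ < b₁ → a₂ < b₂ → Set.Icc a₁ b₁ ×ˢ Set.Icc a₂ b₂ ⊆ S →
    IsBVF g a₁ b₁ a₂ b₂

/-- A quaternion bounded variation function: all four components are of bounded variation. -/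
structure IsQBVFIn (f : ℝ × ℝ → ℍ) (S : Set (ℝ × ℝ)) : Prop where
  re : IsBVFIn (fun p => (f p).re) S
  imI : IsBVFIn (fun p => (f p).imI) S
  imJ : IsBVFIn (fun p => (f p).imJ) S
  imK : IsBVFIn (fun p => (f p).imK) S

/-- The cross-neighbourhood of `(x₀, y₀)` with half-widths `ε₁`, `ε₂`. -/
def crossNeighborhood (x₀ y₀ ε₁ ε₂ : ℝ) : Set (ℝ × ℝ) :=
  {p | |p.1 - x₀| ≤ ε₁ ∨ |p.2 - y₀| ≤ ε₂}

/-- The symmetrisation `f̃` of `f` about the point `(x₀, y₀)`. -/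
def symm (f : ℝ × ℝ → ℍ) (x₀ y₀ s t : ℝ) : ℍ :=
  f (x₀ - s, y₀ - t) + f (x₀ + s, y₀ + t) + f (x₀ - s, y₀ + t) + f (x₀ + s, y₀ - t)

/-- `f` belongs to the class `LC` in the cross-neighbourhood of `(x₀, y₀)` with half-widths
`ε₁`, `ε₂`; the numbers `a` and `b` are subject to `f̃(a, ·) ∈ L¹(ℝ)`, `f̃(·, b) ∈ L¹(ℝ)`. -/
def IsLC (f : ℝ × ℝ → ℍ) (x₀ y₀ ε₁ ε₂ : ℝ) : Prop :=
  (∃ a : ℝ, Integrable (fun t => symm f x₀ y₀ a t) ∧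
    ∫⁻ t in Set.Ioi ε₂, ∫⁻ s in Set.Ioc 0 ε₁,
      ‖s⁻¹ • (symm f x₀ y₀ s t - symm f x₀ y₀ a t)‖ₑ < ⊤) ∧
  (∃ b : ℝ, Integrable (fun s => symm f x₀ y₀ s b) ∧
    ∫⁻ s in Set.Ioi ε₁, ∫⁻ t in Set.Ioc 0 ε₂,
      ‖t⁻¹ • (symm f x₀ y₀ s t - symm f x₀ y₀ s b)‖ₑ < ⊤)

section QuadrantLimits

variable {E : Type*} [NormedAddCommGroup E] [NormedSpace ℝ E]

/-- The four double limits `f(x₀ ± 0, y₀ ± 0)` exist. -/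
def QuadrantLimitsExist (f : ℝ × ℝ → E) (x₀ y₀ : ℝ) : Prop :=
  (∃ l, Tendsto f (𝓝[>] x₀ ×ˢ 𝓝[>] y₀) (𝓝 l)) ∧
  (∃ l, Tendsto f (𝓝[>] x₀ ×ˢ 𝓝[<] y₀) (𝓝 l)) ∧
  (∃ l, Tendsto f (𝓝[<] x₀ ×ˢ 𝓝[>] y₀) (𝓝 l)) ∧
  (∃ l, Tendsto f (𝓝[<] x₀ ×ˢ 𝓝[<] y₀) (𝓝 l))

/-- The mean `η(x₀, y₀)` of the four double limits `f(x₀ ± 0, y₀ ± 0)`; it is meaningful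
when these limits exist. -/
def eta (f : ℝ × ℝ → E) (x₀ y₀ : ℝ) : E :=
  (1 / 4 : ℝ) •
    (limUnder (𝓝[>] x₀ ×ˢ 𝓝[>] y₀) f + limUnder (𝓝[>] x₀ ×ˢ 𝓝[<] y₀) f +
      limUnder (𝓝[<] x₀ ×ˢ 𝓝[>] y₀) f + limUnder (𝓝[<] x₀ ×ˢ 𝓝[<] y₀) f)

end QuadrantLimits

end QFT

end

namespace QFT

open Set
open scoped ENNReal

/-! In each truncated inversion integral two exponentials of the same unit stand next to each other.
By Fubini they can be integrated first, over a symmetric interval, and give a real number, a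
Dirichlet kernel. It leaves the product and lets the exponentials of the other unit meet.
Noncommutativity thus disappears: `rightInversion_eq` and `leftInversion_eq` lead to the same
integral π⁻² ∫ f(s,t) D_M(x₀−s) D_N(y₀−t), D_N(x) = sin(Nx)/x, and since its kernel is real, each
component of `f` can be treated alone.

For a real function, move the point to the origin and fold the plane onto the first quadrant; the
kernel is even, so it now multiplies the sum over the four reflections. Cut the quadrant at ε₁ and
ε₂. Away from both axes 1/(st) is bounded and the Riemann–Lebesgue lemma applies. On a strip along
one axis, LC makes the difference quotient with respect to a section integrable, so Riemann–Lebesgue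
applies to it, while the section itself contributes a bounded sine integral times a vanishing sine
transform. On the corner rectangle each reflection has bounded Hardy variation, and a planar
Dirichlet–Jordan theorem (`HardyVariationOn.tendsto_integral`) gives (π/2)² times its double limit.

The planar theorem is the one-dimensional one used twice. The sections g(s,·) form a curve of
bounded variation in `VariationSpace`; its variation and that of one section of g in the other
direction control the increments in s of ∫ g(s,t) D_N(t) dt uniformly in N. Hence
`tendsto_integral_mul_dirichletKer` is proved for families dominated by one antitone function, which
makes the two limits independent. It rests on a second mean value estimate obtained from the
layer-cake formula. -/

/-! ### Second mean value estimates. -/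

/-- The part of `(a, b]` where an antitone function exceeds a level is an initial interval, up to
a null set. -/
theorem exists_setIntegral_superlevel_eq {k φ : ℝ → ℝ} {a b : ℝ} (hab : a ≤ b) (hk : Antitone k)
    (l : ℝ) : ∃ c ∈ Icc a b,
      ∫ x in Ioc a b ∩ {x | l < k x}, φ x = ∫ x in a..c, φ x := by
  set S := Ioc a b ∩ {x | l < k x} with hS
  rcases S.eq_empty_or_nonempty with h | h
  · exact ⟨a, left_mem_Icc.2 hab, by simp [h]⟩
  have hbdd : BddAbove S := ⟨b, fun x hx => hx.1.2⟩
  obtain ⟨x₀, hx₀⟩ := h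
  have hac : a ≤ sSup S := hx₀.1.1.le.trans (le_csSup hbdd hx₀)
  refine ⟨sSup S, ⟨hac, csSup_le ⟨x₀, hx₀⟩ fun x hx => hx.1.2⟩, ?_⟩
  rw [intervalIntegral.integral_of_le hac]
  -- `S` lies between the open and the half-open interval ending at its supremum, which differ by a
  -- point.
  have h1 : S ⊆ Ioc a (sSup S) := fun x hx => ⟨hx.1.1, le_csSup hbdd hx⟩
  have h2 : Ioo a (sSup S) ⊆ S := fun x hx => by
    obtain ⟨y, hy, hxy⟩ := exists_lt_of_lt_csSup ⟨x₀, hx₀⟩ hx.2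
    exact ⟨⟨hx.1, hxy.le.trans hy.1.2⟩, hy.2.trans_le (hk hxy.le)⟩
  refine setIntegral_congr_set (h1.eventuallyLE.antisymm ?_)
  exact (Ioo_ae_eq_Ioc (μ := volume)).symm.le.trans h2.eventuallyLE

/-- A form of the second mean value theorem: a nonnegative antitone weight bounded by `C`
enlarges a bound of the primitive by at most the factor `C`. -/
theorem abs_integral_mul_le_of_antitoneOn {k φ : ℝ → ℝ} {a b C K : ℝ} (hab : a ≤ b)
    (hk : AntitoneOn k (Ioc a b)) (h0 : ∀ x ∈ Ioc a b, 0 ≤ k x) (hC : ∀ x ∈ Ioc a b, k x ≤ C)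
    (hC0 : 0 ≤ C) (hφ : IntegrableOn φ (Ioc a b)) (hK : ∀ c ∈ Icc a b, |∫ x in a..c, φ x| ≤ K) :
    |∫ x in a..b, k x * φ x| ≤ K * C := by
  -- An extension antitone on all of ℝ is measurable and has initial rays as superlevel sets.
  obtain ⟨k', hk', heq⟩ := hk.exists_antitone_extension
    ⟨0, by rintro _ ⟨x, hx, rfl⟩; exact h0 x hx⟩ ⟨C, by rintro _ ⟨x, hx, rfl⟩; exact hC x hx⟩
  -- Layer cake: `k x` is the length of the set of levels `l` in `(0, C]` below it. After Fubini,
  -- the inner integral at each level is a value of the primitive of `φ`.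
  have hrepr : ∀ x ∈ Ioc a b, k x * φ x =
      ∫ l in Ioc 0 C, {p : ℝ × ℝ | p.2 < k' p.1}.indicator (fun p => φ p.1) (x, l) := by
    intro x hx
    have : ∀ l, {p : ℝ × ℝ | p.2 < k' p.1}.indicator (fun p => φ p.1) (x, l) =
        (Iio (k' x)).indicator (fun _ => φ x) l := fun l => rfl
    simp_rw [this]
    rw [setIntegral_indicator measurableSet_Iio, setIntegral_const, smul_eq_mul]
    have h2 : Ioc 0 C ∩ Iio (k' x) = Ioo 0 (k' x) := by
      ext l
      have := hC x hx
      rw [heq hx] at this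
      simp only [mem_inter_iff, mem_Ioc, mem_Iio, mem_Ioo]
      constructor
      · rintro ⟨⟨h1, -⟩, h3⟩; exact ⟨h1, h3⟩
      · rintro ⟨h1, h3⟩; exact ⟨⟨h1, h3.le.trans this⟩, h3⟩
    rw [h2, Real.volume_real_Ioo_of_le (by rw [← heq hx]; exact h0 x hx), heq hx, sub_zero]
  have hms : MeasurableSet {p : ℝ × ℝ | p.2 < k' p.1} :=
    measurableSet_lt measurable_snd (hk'.measurable.comp measurable_fst)
  rw [intervalIntegral.integral_of_le hab, setIntegral_congr_fun measurableSet_Ioc hrepr,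
    integral_integral_swap]
  · have hb : ∀ l, ‖∫ x in Ioc a b,
        {p : ℝ × ℝ | p.2 < k' p.1}.indicator (fun p => φ p.1) (x, l)‖ ≤ K := by
      intro l
      have : ∀ x, {p : ℝ × ℝ | p.2 < k' p.1}.indicator (fun p => φ p.1) (x, l) =
        {x | l < k' x}.indicator φ x := fun x => rfl
      simp_rw [this]
      rw [setIntegral_indicator (measurableSet_lt measurable_const hk'.measurable)]
      obtain ⟨c, hc, he⟩ := exists_setIntegral_superlevel_eq (φ := φ) hab hk' l
      rw [he]
      exact hK c hc
    have := norm_setIntegral_le_of_norm_le_const (μ := volume) (s := Ioc 0 C)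
      (by simp) (fun l _ => hb l)
    rwa [Real.volume_real_Ioc_of_le hC0, sub_zero] at this
  · exact (Integrable.comp_fst hφ _).indicator hms

/-- The bound for a function whose increments are dominated by those of an antitone function. -/
theorem abs_integral_sub_mul_le_of_dominated {k w φ : ℝ → ℝ} {a b W K : ℝ} (hab : a < b)
    (hkw : ∀ x ∈ Ioc a b, ∀ y ∈ Ioc a b, x ≤ y → |k x - k y| ≤ w x - w y)
    (hW : ∀ x ∈ Ioc a b, w x - w b ≤ W)
    (hφ : IntegrableOn φ (Ioc a b)) (hK : ∀ c ∈ Icc a b, |∫ x in a..c, φ x| ≤ K) :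
    IntegrableOn (fun x => (k x - k b) * φ x) (Ioc a b) ∧
      |∫ x in a..b, (k x - k b) * φ x| ≤ 2 * (K * W) := by
  have hb : b ∈ Ioc a b := right_mem_Ioc.2 hab
  -- Jordan decomposition `k - k b = p - m`: domination by `w` makes both parts antitone,
  -- nonnegative and at most `W`. The two parts account for the factor 2.
  set p : ℝ → ℝ := fun x => (w x - w b + (k x - k b)) / 2 with hp
  set m : ℝ → ℝ := fun x => (w x - w b - (k x - k b)) / 2 with hm
  have hW0 : 0 ≤ W := by simpa using hW b hb
  have key : ∀ q : ℝ → ℝ, AntitoneOn q (Ioc a b) → (∀ x ∈ Ioc a b, 0 ≤ q x) →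
      (∀ x ∈ Ioc a b, q x ≤ W) → IntegrableOn (fun x => q x * φ x) (Ioc a b) ∧
        |∫ x in a..b, q x * φ x| ≤ K * W := by
    intro q hq h0 h1
    refine ⟨?_, abs_integral_mul_le_of_antitoneOn hab.le hq h0 h1 hW0 hφ hK⟩
    refine Integrable.bdd_mul hφ
      (aemeasurable_restrict_of_antitoneOn measurableSet_Ioc hq).aestronglyMeasurable (c := W) ?_
    filter_upwards [ae_restrict_mem measurableSet_Ioc] with x hx
    rw [Real.norm_eq_abs, abs_of_nonneg (h0 x hx)]
    exact h1 x hx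
  have hpk := key p
    (fun x hx y hy hxy => by
      have := abs_le.1 (hkw x hx y hy hxy); simp only [hp]; linarith [this.1])
    (fun x hx => by
      have := abs_le.1 (hkw x hx b hb hx.2); simp only [hp]; linarith [this.1])
    (fun x hx => by
      have := abs_le.1 (hkw x hx b hb hx.2); simp only [hp]; linarith [this.2, hW x hx])
  have hmk := key m
    (fun x hx y hy hxy => by
      have := abs_le.1 (hkw x hx y hy hxy); simp only [hm]; linarith [this.2])
    (fun x hx => by
      have := abs_le.1 (hkw x hx b hb hx.2); simp only [hm]; linarith [this.2])
    (fun x hx => by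
      have := abs_le.1 (hkw x hx b hb hx.2); simp only [hm]; linarith [this.1, hW x hx])
  have hsplit : (fun x => (k x - k b) * φ x) = fun x => p x * φ x - m x * φ x := by
    funext x; simp only [hp, hm]; ring
  rw [hsplit]
  refine ⟨hpk.1.sub hmk.1, ?_⟩
  rw [intervalIntegral.integral_sub ((intervalIntegrable_iff_integrableOn_Ioc_of_le hab.le).2 hpk.1)
    ((intervalIntegrable_iff_integrableOn_Ioc_of_le hab.le).2 hmk.1)]
  have := abs_sub (∫ x in a..b, p x * φ x) (∫ x in a..b, m x * φ x)
  linarith [hpk.2, hmk.2]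

/-- The bound for a dominated function, with the value at the right end. -/
theorem abs_integral_mul_le_of_dominated {k w φ : ℝ → ℝ} {a b W K : ℝ} (hab : a < b)
    (hkw : ∀ x ∈ Ioc a b, ∀ y ∈ Ioc a b, x ≤ y → |k x - k y| ≤ w x - w y)
    (hW : ∀ x ∈ Ioc a b, w x - w b ≤ W)
    (hφ : IntegrableOn φ (Ioc a b)) (hK : ∀ c ∈ Icc a b, |∫ x in a..c, φ x| ≤ K) :
    IntegrableOn (fun x => k x * φ x) (Ioc a b) ∧
      |∫ x in a..b, k x * φ x| ≤ K * (|k b| + 2 * W) := by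
  obtain ⟨h1, h2⟩ := abs_integral_sub_mul_le_of_dominated hab hkw hW hφ hK
  have h3 : IntegrableOn (fun x => k b * φ x) (Ioc a b) := hφ.const_mul _
  have hsplit : (fun x => k x * φ x) = fun x => (k x - k b) * φ x + k b * φ x := by
    funext x; ring
  rw [hsplit]
  refine ⟨h1.add h3, ?_⟩
  rw [intervalIntegral.integral_add ((intervalIntegrable_iff_integrableOn_Ioc_of_le hab.le).2 h1)
    ((intervalIntegrable_iff_integrableOn_Ioc_of_le hab.le).2 h3),
    intervalIntegral.integral_const_mul]
  have h4 : |k b * ∫ x in a..b, φ x| ≤ |k b| * K := by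
    rw [abs_mul]; exact mul_le_mul_of_nonneg_left (hK b ⟨hab.le, le_rfl⟩) (abs_nonneg _)
  have := abs_add_le (∫ x in a..b, (k x - k b) * φ x) (k b * ∫ x in a..b, φ x)
  linarith

/-! ### Dirichlet kernel and sine integral. -/

/-- The Dirichlet kernel `sin (N x) / x`, with its continuous value `N` at the origin. -/
noncomputable def dirichletKer (N x : ℝ) : ℝ := N * Real.sinc (N * x)

/-- The sine integral. -/
noncomputable def sineIntegral (x : ℝ) : ℝ := ∫ t in 0..x, Real.sinc t

theorem continuous_dirichletKer_uncurry :
    Continuous fun p : ℝ × ℝ => dirichletKer p.1 p.2 := by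
  unfold dirichletKer
  exact continuous_fst.mul (Real.continuous_sinc.comp (continuous_fst.mul continuous_snd))

theorem continuous_dirichletKer (N : ℝ) : Continuous (dirichletKer N) :=
  continuous_dirichletKer_uncurry.comp (Continuous.prodMk_right N)

theorem dirichletKer_neg (N x : ℝ) : dirichletKer N (-x) = dirichletKer N x := by
  simp [dirichletKer]

theorem dirichletKer_of_ne_zero (N : ℝ) {x : ℝ} (hx : x ≠ 0) :
    dirichletKer N x = Real.sin (N * x) / x := by
  rcases eq_or_ne N 0 with rfl | hN
  · simp [dirichletKer]
  · rw [dirichletKer, Real.sinc_of_ne_zero (mul_ne_zero hN hx)]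
    field_simp

theorem abs_dirichletKer_le (N x : ℝ) : |dirichletKer N x| ≤ |N| := by
  rw [dirichletKer, abs_mul]
  exact mul_le_of_le_one_right (abs_nonneg _) (Real.abs_sinc_le_one _)

theorem integral_dirichletKer (N a b : ℝ) :
    ∫ x in a..b, dirichletKer N x = sineIntegral (N * b) - sineIntegral (N * a) := by
  have hi : ∀ u v : ℝ, IntervalIntegrable Real.sinc volume u v := fun u v =>
    Real.continuous_sinc.intervalIntegrable u v
  unfold dirichletKer sineIntegral
  rw [intervalIntegral.integral_const_mul, intervalIntegral.mul_integral_comp_mul_left]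
  have := intervalIntegral.integral_add_adjacent_intervals (hi 0 (N * a)) (hi (N * a) (N * b))
  linarith

theorem continuous_sineIntegral : Continuous sineIntegral :=
  intervalIntegral.continuous_primitive
    (fun a b => Real.continuous_sinc.intervalIntegrable a b) 0

theorem sineIntegral_zero : sineIntegral 0 = 0 := by simp [sineIntegral]

theorem sineIntegral_neg (x : ℝ) : sineIntegral (-x) = -sineIntegral x := by
  have := intervalIntegral.integral_comp_neg (a := 0) (b := x) Real.sinc
  simp only [Real.sinc_neg, neg_zero] at this
  rw [sineIntegral, sineIntegral, intervalIntegral.integral_symm, this]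

/-- The weight `x⁻¹` is antitone and at most `a⁻¹`, and primitives of the sine vary by at most 2. -/
theorem abs_sineIntegral_sub_le {a b : ℝ} (ha : 0 < a) (hab : a ≤ b) :
    |sineIntegral b - sineIntegral a| ≤ 2 * a⁻¹ := by
  have h := integral_dirichletKer 1 a b
  rw [one_mul, one_mul] at h
  rw [← h]
  have h2 : ∫ x in a..b, dirichletKer 1 x = ∫ x in a..b, x⁻¹ * Real.sin x := by
    refine intervalIntegral.integral_congr fun x hx => ?_
    rw [uIcc_of_le hab] at hx
    have : x ≠ 0 := (ha.trans_le hx.1).ne'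
    simp only [dirichletKer_of_ne_zero 1 this, one_mul, div_eq_inv_mul]
  rw [h2]
  refine abs_integral_mul_le_of_antitoneOn hab ?_ ?_ ?_ (inv_nonneg.2 ha.le) ?_ ?_
  · intro x hx y hy hxy
    exact inv_anti₀ (ha.trans hx.1) hxy
  · intro x hx
    exact inv_nonneg.2 (ha.trans hx.1).le
  · intro x hx
    exact inv_anti₀ ha hx.1.le
  · exact (intervalIntegrable_iff_integrableOn_Ioc_of_le hab).1
      (Real.continuous_sin.intervalIntegrable a b)
  · intro c _
    rw [integral_sin]
    have h1 := Real.abs_cos_le_one a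
    have h3 := Real.abs_cos_le_one c
    rw [abs_le] at *
    constructor <;> linarith [h1.1, h1.2, h3.1, h3.2]

theorem exists_tendsto_sineIntegral : ∃ L, Tendsto sineIntegral atTop (𝓝 L) := by
  refine cauchy_map_iff_exists_tendsto.1 ?_
  rw [Metric.cauchy_iff]
  refine ⟨inferInstance, fun ε hε => ?_⟩
  -- Beyond `8 / ε` every value is within `ε / 4` of the value there, so two values differ by at
  -- most `ε / 2`.
  have ha : 0 < 8 / ε := by positivity
  refine ⟨sineIntegral '' Ici (8 / ε), image_mem_map (Ici_mem_atTop _), ?_⟩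
  rintro _ ⟨x, hx, rfl⟩ _ ⟨y, hy, rfl⟩
  have h1 := abs_sineIntegral_sub_le ha hx
  have h2 := abs_sineIntegral_sub_le ha hy
  rw [inv_div] at h1 h2
  rw [Real.dist_eq]
  rw [abs_le] at h1 h2
  rw [abs_lt]
  constructor <;> linarith [h1.1, h1.2, h2.1, h2.2]

theorem exists_abs_sineIntegral_le : ∃ K, 0 < K ∧ ∀ x, |sineIntegral x| ≤ K := by
  obtain ⟨C, hC⟩ := (isCompact_Icc (a := (0 : ℝ)) (b := 1)).exists_bound_of_continuousOn
    continuous_sineIntegral.continuousOn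
  have hC0 : 0 ≤ C := (norm_nonneg _).trans (hC 0 (by simp))
  have hpos : ∀ x, 0 ≤ x → |sineIntegral x| ≤ C + 2 := by
    intro x hx
    rcases le_total x 1 with h | h
    · exact (hC x ⟨hx, h⟩).trans (by linarith)
    · have h1 := abs_sineIntegral_sub_le one_pos h
      have h2 := hC 1 (by simp)
      rw [Real.norm_eq_abs] at h2
      have := abs_add_le (sineIntegral x - sineIntegral 1) (sineIntegral 1)
      rw [sub_add_cancel] at this
      linarith
  refine ⟨C + 2, by linarith, fun x => ?_⟩
  rcases le_total 0 x with h | h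
  · exact hpos x h
  · have := hpos (-x) (by linarith)
    rwa [sineIntegral_neg, abs_neg] at this

/-- An antitone function has small oscillation on `(0, δ]` for small `δ`. -/
theorem exists_forall_antitoneOn_sub_le {w : ℝ → ℝ} {ε : ℝ} (hε : 0 < ε)
    (hw : AntitoneOn w (Icc 0 ε)) {r : ℝ} (hr : 0 < r) :
    ∃ δ₀ ∈ Ioo 0 ε, ∀ δ ∈ Ioc 0 δ₀, ∀ x ∈ Ioc 0 δ, w x - w δ ≤ r := by
  -- The interval is open at 0 because `w` may jump there.
  set S := w '' Ioo 0 ε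
  have hne : S.Nonempty := (nonempty_Ioo.2 hε).image w
  have hbdd : BddAbove S := ⟨w 0, by
    rintro _ ⟨x, hx, rfl⟩
    exact hw (left_mem_Icc.2 hε.le) (Ioo_subset_Icc_self hx) hx.1.le⟩
  obtain ⟨_, ⟨δ₀, hδ₀, rfl⟩, hlt⟩ := exists_lt_of_lt_csSup hne (sub_lt_self (sSup S) hr)
  refine ⟨δ₀, hδ₀, fun δ hδ x hx => ?_⟩
  have h1 : w x ≤ sSup S :=
    le_csSup hbdd ⟨x, ⟨hx.1, hx.2.trans_lt (hδ.2.trans_lt hδ₀.2)⟩, rfl⟩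
  have h2 : w δ₀ ≤ w δ := hw ⟨hδ.1.le, hδ.2.trans hδ₀.2.le⟩ (Ioo_subset_Icc_self hδ₀) hδ.2
  linarith

/-- The Dirichlet–Jordan theorem at the left end of an interval, for a family of functions
dominated by one antitone function. -/
theorem tendsto_integral_mul_dirichletKer {ι : Type*} {l : Filter ι} {k : ι → ℝ → ℝ} {w κ : ℝ → ℝ}
    {ε ℓ L : ℝ} (hε : 0 < ε) (hw : AntitoneOn w (Icc 0 ε))
    (hkw : ∀ n, ∀ x ∈ Icc 0 ε, ∀ y ∈ Icc 0 ε, x ≤ y → |k n x - k n y| ≤ w x - w y)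
    (hκ : ∀ δ ∈ Ioc 0 ε, Tendsto (fun n => k n δ) l (𝓝 (κ δ)))
    (hℓ : Tendsto κ (𝓝[>] 0) (𝓝 ℓ)) (hL : Tendsto sineIntegral atTop (𝓝 L)) :
    Tendsto (fun p : ι × ℝ => ∫ s in 0..ε, k p.1 s * dirichletKer p.2 s) (l ×ˢ atTop)
      (𝓝 (L * ℓ)) := by
  obtain ⟨K, hK0, hK⟩ := exists_abs_sineIntegral_le
  have hφ : ∀ M a b, IntegrableOn (dirichletKer M) (Ioc a b) := fun M a b =>
    ((continuous_dirichletKer M).integrableOn_Icc).mono_set Ioc_subset_Icc_self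
  set W := w 0 - w ε with hWdef
  have hmem0 : (0 : ℝ) ∈ Icc 0 ε := left_mem_Icc.2 hε.le
  have hmemε : ε ∈ Icc 0 ε := right_mem_Icc.2 hε.le
  have hW0 : 0 ≤ W := sub_nonneg.2 (hw hmem0 hmemε hε.le)
  -- Cut at a small `δ` chosen from `w` and `κ` alone, hence uniformly in the family, and subtract
  -- from `k` its value at the right end of each piece. On `[0, δ]` the oscillation is at most `r`:
  -- error `2 * K * r`. On `[δ, ε]` the primitive of the kernel is at most `r`: error `2 * r * W`.
  -- The constants contribute a limit `κ δ * L`, off from `L * ℓ` by at most `r * |L|`.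
  have main : ∀ r > 0, ∀ᶠ p : ι × ℝ in l ×ˢ atTop,
      |(∫ s in 0..ε, k p.1 s * dirichletKer p.2 s) - L * ℓ| ≤ r * (2 * K + 2 * W + 2 + |L|) := by
    intro r hr
    obtain ⟨δ₀, hδ₀, hosc⟩ := exists_forall_antitoneOn_sub_le hε hw hr
    obtain ⟨δ, hδ, hδℓ⟩ : ∃ δ ∈ Ioc 0 δ₀, |κ δ - ℓ| ≤ r := by
      have h1 : ∀ᶠ δ in 𝓝[>] (0 : ℝ), |κ δ - ℓ| < r := by
        have := Metric.tendsto_nhds.1 hℓ r hr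
        simpa only [Real.dist_eq] using this
      obtain ⟨δ, h2, h3⟩ := (h1.and (Ioc_mem_nhdsGT hδ₀.1)).exists
      exact ⟨δ, h3, h2.le⟩
    have hδε : δ < ε := hδ.2.trans_lt hδ₀.2
    have hMδ : Tendsto (fun p : ι × ℝ => sineIntegral (p.2 * δ)) (l ×ˢ atTop) (𝓝 L) :=
      (hL.comp (tendsto_id.atTop_mul_const hδ.1)).comp tendsto_snd
    have hMε : Tendsto (fun p : ι × ℝ => sineIntegral (p.2 * ε)) (l ×ˢ atTop) (𝓝 L) :=
      (hL.comp (tendsto_id.atTop_mul_const hε)).comp tendsto_snd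
    have hkδ : Tendsto (fun p : ι × ℝ => k p.1 δ) (l ×ˢ atTop) (𝓝 (κ δ)) :=
      (hκ δ ⟨hδ.1, hδε.le⟩).comp tendsto_fst
    have hkε : Tendsto (fun p : ι × ℝ => k p.1 ε) (l ×ˢ atTop) (𝓝 (κ ε)) :=
      (hκ ε ⟨hε, le_rfl⟩).comp tendsto_fst
    have hlim : Tendsto (fun p : ι × ℝ => k p.1 δ * sineIntegral (p.2 * δ) +
        k p.1 ε * (sineIntegral (p.2 * ε) - sineIntegral (p.2 * δ))) (l ×ˢ atTop)
        (𝓝 (κ δ * L)) := by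
      simpa using (hkδ.mul hMδ).add (hkε.mul (hMε.sub hMδ))
    have hev1 : ∀ᶠ p : ι × ℝ in l ×ˢ atTop, |k p.1 δ * sineIntegral (p.2 * δ) +
        k p.1 ε * (sineIntegral (p.2 * ε) - sineIntegral (p.2 * δ)) - κ δ * L| < r := by
      have := Metric.tendsto_nhds.1 hlim r hr
      simpa only [Real.dist_eq] using this
    have hev2 : ∀ᶠ p : ι × ℝ in l ×ˢ atTop, 0 < p.2 ∧ 2 * (p.2 * δ)⁻¹ ≤ r := by
      have h0 : Tendsto (fun p : ι × ℝ => 2 * (p.2 * δ)⁻¹) (l ×ˢ atTop) (𝓝 0) := by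
        have := ((tendsto_inv_atTop_zero.comp
          (tendsto_id.atTop_mul_const hδ.1)).comp (tendsto_snd (f := l))).const_mul (2 : ℝ)
        simpa using this
      have h1 := h0.eventually_le_const hr
      filter_upwards [h1, tendsto_snd.eventually (eventually_gt_atTop (0 : ℝ))] with p h2 h3
      exact ⟨h3, h2⟩
    filter_upwards [hev1, hev2] with p h1 h2
    obtain ⟨hi1, hb1⟩ := abs_integral_sub_mul_le_of_dominated (k := k p.1) (w := w) (W := r)
      (K := K) hδ.1
      (fun x hx y hy hxy => hkw p.1 x ⟨hx.1.le, hx.2.trans hδε.le⟩ y ⟨hy.1.le, hy.2.trans hδε.le⟩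
        hxy) (hosc δ hδ) (hφ p.2 0 δ)
      (fun c _ => by
        rw [integral_dirichletKer, mul_zero, sineIntegral_zero, sub_zero]; exact hK _)
    obtain ⟨hi2, hb2⟩ := abs_integral_sub_mul_le_of_dominated (k := k p.1) (w := w) (W := W)
      (K := r) hδε
      (fun x hx y hy hxy => hkw p.1 x ⟨hδ.1.le.trans hx.1.le, hx.2⟩ y
        ⟨hδ.1.le.trans hy.1.le, hy.2⟩ hxy)
      (fun x hx => by
        have := hw hmem0 ⟨hδ.1.le.trans hx.1.le, hx.2⟩ (hδ.1.le.trans hx.1.le)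
        simp only [hWdef]; linarith) (hφ p.2 δ ε)
      (fun c hc => by
        rw [integral_dirichletKer]
        exact (abs_sineIntegral_sub_le (mul_pos h2.1 hδ.1)
          (mul_le_mul_of_nonneg_left hc.1 h2.1.le)).trans h2.2)
    have hii : ∀ a b c : ℝ, IntervalIntegrable (fun s => c * dirichletKer p.2 s) volume a b :=
      fun a b c => (continuous_const.mul (continuous_dirichletKer p.2)).intervalIntegrable a b
    have hs1 : (∫ s in 0..δ, k p.1 s * dirichletKer p.2 s) =
        (∫ s in 0..δ, (k p.1 s - k p.1 δ) * dirichletKer p.2 s) +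
          k p.1 δ * sineIntegral (p.2 * δ) := by
      have hh := intervalIntegral.integral_add
        ((intervalIntegrable_iff_integrableOn_Ioc_of_le hδ.1.le).2 hi1) (hii 0 δ (k p.1 δ))
      rw [intervalIntegral.integral_const_mul, integral_dirichletKer, mul_zero, sineIntegral_zero,
        sub_zero] at hh
      rw [← hh]
      congr 1; funext s; ring
    have hs2 : (∫ s in δ..ε, k p.1 s * dirichletKer p.2 s) =
        (∫ s in δ..ε, (k p.1 s - k p.1 ε) * dirichletKer p.2 s) +
          k p.1 ε * (sineIntegral (p.2 * ε) - sineIntegral (p.2 * δ)) := by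
      have hh := intervalIntegral.integral_add
        ((intervalIntegrable_iff_integrableOn_Ioc_of_le hδε.le).2 hi2) (hii δ ε (k p.1 ε))
      rw [intervalIntegral.integral_const_mul, integral_dirichletKer] at hh
      rw [← hh]
      congr 1; funext s; ring
    have hi1' : IntervalIntegrable (fun s => k p.1 s * dirichletKer p.2 s) volume 0 δ := by
      have := ((intervalIntegrable_iff_integrableOn_Ioc_of_le hδ.1.le).2 hi1).add
        (hii 0 δ (k p.1 δ))
      refine this.congr ?_
      exact fun s _ => by ring
    have hi2' : IntervalIntegrable (fun s => k p.1 s * dirichletKer p.2 s) volume δ ε := by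
      have := ((intervalIntegrable_iff_integrableOn_Ioc_of_le hδε.le).2 hi2).add
        (hii δ ε (k p.1 ε))
      refine this.congr ?_
      exact fun s _ => by ring
    rw [← intervalIntegral.integral_add_adjacent_intervals hi1' hi2', hs1, hs2]
    have h3 : |(κ δ - ℓ) * L| ≤ r * |L| := by
      rw [abs_mul]; exact mul_le_mul_of_nonneg_right hδℓ (abs_nonneg _)
    rw [abs_le] at *
    rw [abs_lt] at h1
    constructor <;> nlinarith [h1.1, h1.2, h3.1, h3.2, hb1.1, hb1.2, hb2.1, hb2.2]
  rw [Metric.tendsto_nhds]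
  intro e he
  have hc : 0 < 2 * K + 2 * W + 2 + |L| := by positivity
  filter_upwards [main (e / 2 / (2 * K + 2 * W + 2 + |L|)) (by positivity)] with p hp
  rw [Real.dist_eq]
  rw [div_mul_cancel₀ _ hc.ne'] at hp
  linarith

/-! ### Riemann–Lebesgue lemma in one and two variables. -/

section RiemannLebesgue

variable {V : Type*} [NormedAddCommGroup V] [NormedSpace ℝ V]
    [MeasurableSpace V] [BorelSpace V]

theorem integrable_ofReal_mul_cexp_strongDual {μ : Measure V} {F : V → ℝ} (hF : Integrable F μ)
    (w : StrongDual ℝ V) :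
    Integrable (fun v => (F v : ℂ) * Complex.exp ((-(w v) : ℝ) * Complex.I)) μ := by
  refine hF.ofReal.mul_bdd (c := 1) ?_ (ae_of_all _ fun v => ?_)
  · exact Continuous.aestronglyMeasurable (by fun_prop)
  · rw [Complex.norm_exp_ofReal_mul_I]

variable [FiniteDimensional ℝ V]

/-- The Riemann–Lebesgue lemma for the frequency `w` without the factor `2π`. -/
theorem tendsto_integral_mul_cexp_strongDual (μ : Measure V)
    [μ.IsAddHaarMeasure] (F : V → ℝ) :
    Tendsto (fun w : StrongDual ℝ V =>
      ∫ v, (F v : ℂ) * Complex.exp ((-(w v) : ℝ) * Complex.I) ∂μ)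
      (cocompact (StrongDual ℝ V)) (𝓝 0) := by
  have h1 := tendsto_integral_exp_smul_cocompact (fun v => (F v : ℂ)) μ
  have hscale : Tendsto (fun w : StrongDual ℝ V => (2 * Real.pi)⁻¹ • w)
      (cocompact (StrongDual ℝ V)) (cocompact (StrongDual ℝ V)) :=
    (Homeomorph.smulOfNeZero (α := StrongDual ℝ V) ((2 * Real.pi)⁻¹ : ℝ)
      (by positivity)).isClosedEmbedding.tendsto_cocompact
  refine (h1.comp hscale).congr fun w => ?_
  refine integral_congr_ae (ae_of_all _ fun v => ?_)
  simp only [Circle.smul_def, Real.fourierChar_apply, smul_eq_mul, smul_apply]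
  rw [mul_comm]
  congr 3
  push_cast
  have : (Real.pi : ℂ) ≠ 0 := by exact_mod_cast Real.pi_ne_zero
  field_simp

theorem tendsto_integral_mul_cos_strongDual {μ : Measure V}
    [μ.IsAddHaarMeasure] {F : V → ℝ} (hF : Integrable F μ) :
    Tendsto (fun w : StrongDual ℝ V => ∫ v, F v * Real.cos (w v) ∂μ)
      (cocompact (StrongDual ℝ V)) (𝓝 0) := by
  have h := (Complex.continuous_re.tendsto 0).comp (tendsto_integral_mul_cexp_strongDual μ F)
  rw [Complex.zero_re] at h
  refine h.congr fun w => ?_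
  have h3 := Complex.reCLM.integral_comp_comm (integrable_ofReal_mul_cexp_strongDual hF w)
  simp only [Complex.reCLM_apply] at h3
  simp only [Function.comp_apply]
  rw [← h3]
  simp only [Complex.re_ofReal_mul, Complex.exp_ofReal_mul_I_re, Real.cos_neg]

theorem tendsto_integral_mul_sin_strongDual {μ : Measure V}
    [μ.IsAddHaarMeasure] {F : V → ℝ} (hF : Integrable F μ) :
    Tendsto (fun w : StrongDual ℝ V => ∫ v, F v * Real.sin (w v) ∂μ)
      (cocompact (StrongDual ℝ V)) (𝓝 0) := by
  have h := ((Complex.continuous_im.tendsto 0).comp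
    (tendsto_integral_mul_cexp_strongDual μ F)).neg
  rw [Complex.zero_im, neg_zero] at h
  refine h.congr fun w => ?_
  have h3 := Complex.imCLM.integral_comp_comm (integrable_ofReal_mul_cexp_strongDual hF w)
  simp only [Complex.imCLM_apply] at h3
  simp only [Function.comp_apply]
  rw [← h3]
  simp only [Complex.im_ofReal_mul, Complex.exp_ofReal_mul_I_im, Real.sin_neg, mul_neg,
    integral_neg, neg_neg]

end RiemannLebesgue

/-- The operator norm dominates evaluation at `v`, so one diverging coordinate of the frequency is
enough. -/
theorem tendsto_cocompact_strongDual_of_apply {V ι : Type*} [NormedAddCommGroup V]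
    [NormedSpace ℝ V] [FiniteDimensional ℝ V] {l : Filter ι} {w : ι → StrongDual ℝ V} (v : V)
    (hv : ‖v‖ ≤ 1) (h : Tendsto (fun i => ‖w i v‖) l atTop) :
    Tendsto w l (cocompact (StrongDual ℝ V)) := by
  have : ProperSpace (StrongDual ℝ V) := FiniteDimensional.proper ℝ _
  rw [← Metric.cobounded_eq_cocompact, ← tendsto_norm_atTop_iff_cobounded]
  refine tendsto_atTop_mono (fun i => ?_) h
  calc ‖w i v‖ ≤ ‖w i‖ * ‖v‖ := (w i).le_opNorm v
    _ ≤ ‖w i‖ := mul_le_of_le_one_right (norm_nonneg _) hv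

/-- The Riemann–Lebesgue lemma for the sine on the line. -/
theorem tendsto_integral_mul_sin {F : ℝ → ℝ} (hF : Integrable F) :
    Tendsto (fun N => ∫ t, F t * Real.sin (N * t)) atTop (𝓝 0) := by
  have h : Tendsto (fun N : ℝ => N • ContinuousLinearMap.id ℝ ℝ) atTop
      (cocompact (StrongDual ℝ ℝ)) := by
    refine tendsto_cocompact_strongDual_of_apply 1 (by simp) ?_
    simpa using tendsto_abs_atTop_atTop
  refine ((tendsto_integral_mul_sin_strongDual hF).comp h).congr fun N => ?_
  simp

/-- The Riemann–Lebesgue lemma for products of sines, with both frequencies tending to infinity. -/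
theorem tendsto_integral_mul_sin_mul_sin {F : ℝ × ℝ → ℝ} (hF : Integrable F) :
    Tendsto (fun q : ℝ × ℝ => ∫ p : ℝ × ℝ, F p * (Real.sin (q.2 * p.1) * Real.sin (q.1 * p.2)))
      (atTop ×ˢ atTop) (𝓝 0) := by
  -- The values `c = -1` and `c = 1` give the frequencies of the two cosines in sin A sin B = (cos(A
  -- − B) − cos(A + B))/2.
  have h : ∀ c : ℝ, Tendsto (fun q : ℝ × ℝ => q.2 • ContinuousLinearMap.fst ℝ ℝ ℝ +
      (c * q.1) • ContinuousLinearMap.snd ℝ ℝ ℝ) (atTop ×ˢ atTop)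
      (cocompact (StrongDual ℝ (ℝ × ℝ))) := by
    intro c
    refine tendsto_cocompact_strongDual_of_apply (1, 0) (by simp) ?_
    have : Tendsto (fun q : ℝ × ℝ => |q.2|) (atTop ×ˢ atTop) atTop :=
      tendsto_abs_atTop_atTop.comp tendsto_snd
    simpa using this
  have h1 := (tendsto_integral_mul_cos_strongDual hF).comp (h (-1))
  have h2 := (tendsto_integral_mul_cos_strongDual hF).comp (h 1)
  have h3 := (h1.sub h2).const_mul (1 / 2)
  rw [sub_zero, mul_zero] at h3
  refine h3.congr fun q => ?_
  have hi : ∀ w : StrongDual ℝ (ℝ × ℝ), Integrable fun v => F v * Real.cos (w v) := fun w =>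
    hF.mul_bdd (c := 1) (Continuous.aestronglyMeasurable (by fun_prop))
      (ae_of_all _ fun v => Real.abs_cos_le_one _)
  simp only [Function.comp_apply]
  rw [← integral_sub (hi _) (hi _), ← integral_const_mul]
  refine integral_congr_ae (ae_of_all _ fun p => ?_)
  simp only [add_apply, smul_apply,
    ContinuousLinearMap.coe_fst', ContinuousLinearMap.coe_snd', smul_eq_mul, neg_mul, one_mul,
    Real.cos_add, Real.cos_neg, Real.sin_neg]
  ring

/-! ### Value of the Dirichlet integral. -/

theorem integral_exp_neg_mul_cos (v : ℝ) :
    ∫ s in Ioi (0 : ℝ), Real.exp (-s) * Real.cos (v * s) = (1 + v ^ 2)⁻¹ := by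
  have ha : (-1 + v * Complex.I).re < 0 := by simp
  have h := integral_exp_mul_complex_Ioi ha 0
  have hi := integrableOn_exp_mul_complex_Ioi ha 0
  have h3 := Complex.reCLM.integral_comp_comm hi
  simp only [Complex.reCLM_apply, h] at h3
  have h4 : ∀ s : ℝ, (Complex.exp ((-1 + v * Complex.I) * s)).re =
      Real.exp (-s) * Real.cos (v * s) := by
    intro s
    rw [Complex.exp_re]
    simp
  simp only [h4] at h3
  rw [h3]
  simp [Complex.normSq_apply, Complex.div_re]
  ring_nf

/-- The kernel is ∫₀ᴺ cos(vs) dv; exchanging the integrals leaves ∫₀ᴺ dv/(1 + v²). -/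
theorem integral_exp_neg_mul_dirichletKer (N : ℝ) :
    ∫ s in Ioi (0 : ℝ), Real.exp (-s) * dirichletKer N s = Real.arctan N := by
  have hexp : IntegrableOn (fun s => Real.exp (-s)) (Ioi (0 : ℝ)) := integrableOn_exp_neg_Ioi 0
  have hker : ∀ s : ℝ, ∫ v in 0..N, Real.cos (v * s) = dirichletKer N s := by
    intro s
    rcases eq_or_ne s 0 with rfl | hs
    · simp [dirichletKer]
    · rw [dirichletKer_of_ne_zero N hs, intervalIntegral.integral_comp_mul_right _ hs,
        integral_cos]
      simp [div_eq_inv_mul]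
  have h1 : Real.arctan N = ∫ v in 0..N, ∫ s in Ioi (0 : ℝ), Real.exp (-s) * Real.cos (v * s) := by
    simp_rw [integral_exp_neg_mul_cos]
    simp
  rw [h1, intervalIntegral_integral_swap]
  · refine integral_congr_ae (ae_of_all _ fun s => ?_)
    simp only [intervalIntegral.integral_const_mul, hker]
  · have : IsFiniteMeasure (volume.restrict (uIoc 0 N)) := ⟨by simp [uIoc]⟩
    have hprod : Integrable (fun p : ℝ × ℝ => Real.exp (-p.2))
        ((volume.restrict (uIoc 0 N)).prod (volume.restrict (Ioi 0))) :=
      Integrable.comp_snd hexp _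
    refine hprod.mul_bdd (c := 1) (Continuous.aestronglyMeasurable (by fun_prop))
      (ae_of_all _ fun p => Real.abs_cos_le_one _)

/-- The limit `L`, so far only known to exist, is found by testing on e^{-s}: `[0, 1]` contributes
`L` by Dirichlet–Jordan, the rest vanishes by Riemann–Lebesgue, and the total is arctan N. -/
theorem tendsto_sineIntegral : Tendsto sineIntegral atTop (𝓝 (Real.pi / 2)) := by
  obtain ⟨L, hL⟩ := exists_tendsto_sineIntegral
  have hexp : IntegrableOn (fun s => Real.exp (-s)) (Ioi (0 : ℝ)) := integrableOn_exp_neg_Ioi 0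
  have h1 := tendsto_integral_mul_dirichletKer (ι := Unit) (l := pure ()) (ε := 1)
    (k := fun _ s => Real.exp (-s)) (w := fun s => Real.exp (-s)) (κ := fun s => Real.exp (-s))
    (ℓ := 1) one_pos (fun x _ y _ h => Real.exp_le_exp.2 (neg_le_neg h))
    (fun _ x _ y _ h => (abs_of_nonneg (sub_nonneg.2 (Real.exp_le_exp.2 (neg_le_neg h)))).le)
    (fun δ _ => tendsto_const_nhds)
    (by
      have : Tendsto (fun s : ℝ => Real.exp (-s)) (𝓝 0) (𝓝 1) := by
        have h : Continuous fun s : ℝ => Real.exp (-s) := by fun_prop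
        simpa using h.tendsto 0
      exact this.mono_left nhdsWithin_le_nhds) hL
  have h2 : Tendsto (fun N : ℝ => ∫ s in 0..1, Real.exp (-s) * dirichletKer N s) atTop
      (𝓝 (L * 1)) := by
    have h : Tendsto (fun N : ℝ => ((), N)) atTop (pure () ×ˢ atTop) :=
      tendsto_const_pure.prodMk tendsto_id
    exact h1.comp h
  set F : ℝ → ℝ := (Ioi (1 : ℝ)).indicator fun s => Real.exp (-s) / s with hFdef
  have hF : Integrable F := by
    rw [integrable_indicator_iff measurableSet_Ioi]
    refine Integrable.mono' (integrableOn_exp_neg_Ioi 1) ?_ ?_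
    · exact (Measurable.aestronglyMeasurable (by fun_prop))
    · filter_upwards [ae_restrict_mem measurableSet_Ioi] with s hs
      have hs1 : (1 : ℝ) < s := hs
      rw [Real.norm_eq_abs, abs_div, abs_of_pos (Real.exp_pos _),
        abs_of_pos (one_pos.trans hs1)]
      exact div_le_self (Real.exp_pos _).le hs1.le
  have h3 := tendsto_integral_mul_sin hF
  have h4 := h2.add h3
  have h5 : Tendsto Real.arctan atTop (𝓝 (L * 1 + 0)) := by
    refine h4.congr fun N => ?_
    have hint : ∀ S ⊆ Ioi (0 : ℝ), IntegrableOn (fun s => Real.exp (-s) * dirichletKer N s) S := by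
      intro S hS
      refine ((hexp.mono_set hS).mul_bdd (c := |N|) ?_ (ae_of_all _ fun s => ?_))
      · exact (continuous_dirichletKer N).aestronglyMeasurable
      · exact abs_dirichletKer_le N s
    rw [← integral_exp_neg_mul_dirichletKer, ← Ioc_union_Ioi_eq_Ioi (zero_le_one (α := ℝ)),
      setIntegral_union (Ioc_disjoint_Ioi le_rfl) measurableSet_Ioi
        (hint _ Ioc_subset_Ioi_self) (hint _ (Ioi_subset_Ioi zero_le_one)),
      intervalIntegral.integral_of_le zero_le_one]
    congr 1
    rw [← integral_indicator measurableSet_Ioi]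
    refine integral_congr_ae (ae_of_all _ fun s => ?_)
    by_cases hs : s ∈ Ioi (1 : ℝ)
    · have : s ≠ 0 := (one_pos.trans hs).ne'
      simp only [hFdef, indicator_of_mem hs, dirichletKer_of_ne_zero N this]
      ring
    · simp [hFdef, indicator_of_notMem hs]
  have h6 := tendsto_nhds_unique h5 (tendsto_nhds_of_tendsto_nhdsWithin Real.tendsto_arctan_atTop)
  rw [← h6]
  simpa using hL

/-! ### Hardy variation as the variation of a curve of sections. -/

theorem eVariationOn_add_le {α : Type*} [LinearOrder α] (f g : α → ℝ) (s : Set α) :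
    eVariationOn (f + g) s ≤ eVariationOn f s + eVariationOn g s := by
  refine iSup_le ?_
  rintro ⟨n, u, hu, us⟩
  calc ∑ i ∈ Finset.range n, edist ((f + g) (u (i + 1))) ((f + g) (u i))
      ≤ ∑ i ∈ Finset.range n, (edist (f (u (i + 1))) (f (u i)) +
          edist (g (u (i + 1))) (g (u i))) :=
        Finset.sum_le_sum fun i _ => edist_add_add_le _ _ _ _
    _ ≤ _ := by
      rw [Finset.sum_add_distrib]
      exact add_le_add (eVariationOn.sum_le hu us) (eVariationOn.sum_le hu us)

theorem eVariationOn_neg {α : Type*} [LinearOrder α] (f : α → ℝ) (s : Set α) :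
    eVariationOn (-f) s = eVariationOn f s := by
  simp [eVariationOn, edist_neg_neg]

/-- The variation on a set is the supremum of the variations on its finite subsets. -/
theorem eVariationOn_eq_iSup_finset {α E : Type*} [LinearOrder α] [PseudoEMetricSpace E]
    (f : α → E) (s : Set α) :
    eVariationOn f s = ⨆ T : {T : Finset α // (T : Set α) ⊆ s}, eVariationOn f T.1 := by
  refine le_antisymm (iSup_le ?_) (iSup_le fun T => eVariationOn.mono f T.2)
  rintro ⟨n, u, hu, us⟩
  refine le_iSup_of_le (⟨(Finset.range (n + 1)).image u, ?_⟩ : {T : Finset α // (T : Set α) ⊆ s}) ?_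
  · intro x hx
    simp only [Finset.coe_image, mem_image] at hx
    obtain ⟨i, -, rfl⟩ := hx
    exact us i
  · have h := eVariationOn.image_range_of_monotone f hu n
    have hset : (((Finset.range (n + 1)).image u : Finset α) : Set α) = u '' Iic n := by
      ext x; simp
    simp only [hset, h]
    exact (Finset.sum_congr rfl fun i _ => edist_comm _ _).le

/-- The points of a finite subset of `[a, b]` occur in a subdivision of `[a, b]`. -/
theorem exists_isSubdivision_of_finset {a b : ℝ} (hab : a < b) (T : Finset ℝ)
    (hT : (T : Set ℝ) ⊆ Icc a b) :
    ∃ n t, IsSubdivision a b n t ∧ Monotone t ∧ (T : Set ℝ) ⊆ t '' Iic n := by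
  set S : Finset ℝ := insert a (insert b T) with hS
  have hpos : 0 < S.card := Finset.card_pos.2 ⟨a, by simp [hS]⟩
  obtain ⟨n, hn⟩ := Nat.exists_eq_add_of_lt hpos
  rw [zero_add] at hn
  have hSab : ∀ x ∈ S, x ∈ Icc a b := by
    intro x hx
    simp only [hS, Finset.mem_insert] at hx
    rcases hx with rfl | rfl | hx
    · exact left_mem_Icc.2 hab.le
    · exact right_mem_Icc.2 hab.le
    · exact hT hx
  let e := S.orderEmbOfFin hn
  -- The increasing enumeration of `S`, which has `n + 1` points, kept constant beyond `n` so that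
  -- it is monotone on all of ℕ.
  let t : ℕ → ℝ := fun i => e ⟨min i n, by omega⟩
  have hran : ∀ x ∈ S, ∃ i ≤ n, t i = x := by
    intro x hx
    have : x ∈ Set.range e := by
      rw [Finset.range_orderEmbOfFin]; exact hx
    obtain ⟨i, rfl⟩ := this
    refine ⟨i, by omega, ?_⟩
    simp only [t]
    congr 1
    ext
    simp
    omega
  have hmono : Monotone t := fun i j hij => e.monotone (by
    rw [Fin.le_def]; exact min_le_min_right n hij)
  have hmem : ∀ i, t i ∈ Icc a b := fun i => hSab _ (Finset.orderEmbOfFin_mem S hn _)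
  refine ⟨n, t, ⟨?_, ?_, ?_⟩, hmono, ?_⟩
  · obtain ⟨i, -, hi⟩ := hran a (by simp [hS])
    exact le_antisymm (hi ▸ hmono (Nat.zero_le i)) (hmem 0).1
  · obtain ⟨i, hin, hi⟩ := hran b (by simp [hS])
    exact le_antisymm (hmem n).2 (hi ▸ hmono hin)
  · intro i hi j hj hij
    refine e.strictMono ?_
    rw [Fin.lt_def]
    simp only [mem_Iic] at hi hj
    simp only [min_eq_left hi, min_eq_left hj]
    exact hij
  · intro x hx
    obtain ⟨i, hin, hi⟩ := hran x (by simp [hS]; right; right; exact_mod_cast hx)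
    exact ⟨i, hin, hi⟩

/-- Variations of finitely many functions are computed simultaneously by subdivisions. -/
theorem sum_eVariationOn_Icc_le {ι E : Type*} [PseudoEMetricSpace E] {a b : ℝ} (hab : a < b)
    (k : ι → ℝ → E) (I : Finset ι) (C : ℝ≥0∞)
    (h : ∀ n t, IsSubdivision a b n t →
      ∑ i ∈ I, ∑ j ∈ Finset.range n, edist (k i (t j)) (k i (t (j + 1))) ≤ C) :
    ∑ i ∈ I, eVariationOn (k i) (Icc a b) ≤ C := by
  -- Finite subsets are directed under union, so the supremum commutes with the sum over `I`.
  rw [Finset.sum_congr rfl fun i _ => eVariationOn_eq_iSup_finset (k i) (Icc a b),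
    ENNReal.finsetSum_iSup]
  · refine iSup_le fun T => ?_
    obtain ⟨n, t, ht, hmono, hTt⟩ := exists_isSubdivision_of_finset hab T.1 T.2
    refine le_trans (Finset.sum_le_sum fun i _ => ?_) (h n t ht)
    rw [← eVariationOn.image_range_of_monotone _ hmono]
    exact eVariationOn.mono _ hTt
  · intro S T
    refine ⟨⟨S.1 ∪ T.1, by rw [Finset.coe_union]; exact union_subset S.2 T.2⟩, fun i => ⟨?_, ?_⟩⟩
    · exact eVariationOn.mono _ (by simp)
    · exact eVariationOn.mono _ (by simp)

/-- Real functions, with the variation on `B` of the difference as distance. -/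
def VariationSpace (_B : Set ℝ) : Type := ℝ → ℝ

/-- With this distance, which ignores constants, the mixed variation of a function of two variables
is the `eVariationOn` of its section map, so one-variable results on variation apply to it. -/
noncomputable instance (B : Set ℝ) : PseudoEMetricSpace (VariationSpace B) where
  edist k k' := eVariationOn (fun t => k t - k' t : ℝ → ℝ) B
  edist_self k := by
    simp_rw [sub_self]
    exact eVariationOn.constant_on (by
      rintro _ ⟨x, -, rfl⟩ _ ⟨y, -, rfl⟩; rfl)
  edist_comm k k' := by
    rw [← eVariationOn_neg]
    congr 1
    funext t
    simp
  edist_triangle k k' k'' := by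
    refine le_trans (le_of_eq ?_) (eVariationOn_add_le _ _ _)
    congr 1
    funext t
    simp

/-- The sections `g(s, ·)` of a function of two variables. -/
def sectionMap (g : ℝ × ℝ → ℝ) (B : Set ℝ) (s : ℝ) : VariationSpace B := fun t => g (s, t)

theorem edist_sectionMap (g : ℝ × ℝ → ℝ) (B : Set ℝ) (s s' : ℝ) :
    edist (sectionMap g B s) (sectionMap g B s') =
      eVariationOn (fun t => g (s, t) - g (s', t)) B := rfl

/-- Bounded variation in the sense of Hardy on `A × B`, with the mixed variation expressed as the
variation of the section map, and all sections of bounded variation. -/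
structure HardyVariationOn (g : ℝ × ℝ → ℝ) (A B : Set ℝ) : Prop where
  mixed : eVariationOn (sectionMap g B) A ≠ ⊤
  fst : ∀ σ ∈ A, BoundedVariationOn (fun t => g (σ, t)) B
  snd : ∀ τ ∈ B, BoundedVariationOn (fun s => g (s, τ)) A

/-- An increment of `k - k'` between two points is at most its variation. Hence bounded mixed
variation passes to g(·,τ) − g(·,τ₀). -/
theorem lipschitzOnWith_eval_sub {B : Set ℝ} {τ τ₀ : ℝ} (hτ : τ ∈ B) (hτ₀ : τ₀ ∈ B) :
    LipschitzWith 1 (fun k : VariationSpace B => (k τ - k τ₀ : ℝ)) := by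
  intro k k'
  rw [ENNReal.coe_one, one_mul]
  refine le_trans (le_of_eq ?_) (eVariationOn.edist_le (fun t => k t - k' t : ℝ → ℝ) hτ hτ₀)
  simp only [edist_dist, Real.dist_eq]
  congr 2
  ring

/-- Passing from subdivisions to variations in both variables bounds the mixed variation. Any two
parallel sections then differ by a function of bounded variation, so one good section in each
direction makes all of them good. -/
theorem IsBVF.hardyVariationOn {g : ℝ × ℝ → ℝ} {a₁ b₁ a₂ b₂ : ℝ} (h₁ : a₁ < b₁) (h₂ : a₂ < b₂)
    (h : IsBVF g a₁ b₁ a₂ b₂) : HardyVariationOn g (Icc a₁ b₁) (Icc a₂ b₂) := by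
  have hmixed : eVariationOn (sectionMap g (Icc a₂ b₂)) (Icc a₁ b₁) ≠ ⊤ := by
    obtain ⟨C, hC⟩ := h.bounded_nets
    refine ne_top_of_le_ne_top (ENNReal.ofReal_ne_top (r := C)) ?_
    have := sum_eVariationOn_Icc_le (ι := Unit) h₁ (fun _ => sectionMap g (Icc a₂ b₂)) {()}
      (ENNReal.ofReal C) ?_
    · simpa using this
    intro m s hs
    rw [Finset.sum_singleton]
    -- All strips between consecutive `s i` must be refined by one common subdivision in `t`, since
    -- the hypothesis concerns product nets.
    refine sum_eVariationOn_Icc_le h₂ (fun i t => g (s i, t) - g (s (i + 1), t)) _ _ ?_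
    intro n t ht
    refine le_trans (le_of_eq ?_) (ENNReal.ofReal_le_ofReal (hC m n s t hs ht))
    rw [ENNReal.ofReal_sum_of_nonneg fun i _ => Finset.sum_nonneg fun j _ => abs_nonneg _]
    refine Finset.sum_congr rfl fun i _ => ?_
    rw [ENNReal.ofReal_sum_of_nonneg fun j _ => abs_nonneg _]
    refine Finset.sum_congr rfl fun j _ => ?_
    rw [edist_dist, Real.dist_eq, mixedDiff]
    congr 2
    ring
  refine ⟨hmixed, fun σ hσ => ?_, fun τ hτ => ?_⟩
  · obtain ⟨σ₀, hσ₀, hbv⟩ := h.section_fst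
    have h1 := eVariationOn.edist_le (sectionMap g (Icc a₂ b₂)) hσ hσ₀
    rw [edist_sectionMap] at h1
    have h2 := eVariationOn_add_le (fun t => g (σ, t) - g (σ₀, t)) (fun t => g (σ₀, t)) (Icc a₂ b₂)
    refine ne_top_of_le_ne_top
      (ENNReal.add_ne_top.2 ⟨ne_top_of_le_ne_top hmixed h1, hbv⟩) (le_trans (le_of_eq ?_) h2)
    congr 1; funext t; simp
  · obtain ⟨τ₀, hτ₀, hbv⟩ := h.section_snd
    have h1 := (lipschitzOnWith_eval_sub hτ hτ₀).comp_boundedVariationOn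
      (g := sectionMap g (Icc a₂ b₂)) (s := Icc a₁ b₁) hmixed
    have h2 := eVariationOn_add_le (fun s => g (s, τ) - g (s, τ₀)) (fun s => g (s, τ₀)) (Icc a₁ b₁)
    refine ne_top_of_le_ne_top (ENNReal.add_ne_top.2 ⟨h1, hbv⟩) (le_trans (le_of_eq ?_) h2)
    congr 1; funext t; simp

theorem eVariationOn_comp_le {E : Type*} [PseudoEMetricSpace E] (f : ℝ → E) {s t : Set ℝ}
    {φ : ℝ → ℝ} (hφ : MonotoneOn φ t ∨ AntitoneOn φ t) (hst : MapsTo φ t s) :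
    eVariationOn (f ∘ φ) t ≤ eVariationOn f s :=
  hφ.elim (fun h => eVariationOn.comp_le_of_monotoneOn f φ h hst)
    (fun h => eVariationOn.comp_le_of_antitoneOn f φ h hst)

/-- Serves to bring each of the four quadrants at the point to the corner at the origin by x₀ ± s,
y₀ ± t. -/
theorem HardyVariationOn.comp {g : ℝ × ℝ → ℝ} {A B A' B' : Set ℝ} (h : HardyVariationOn g A B)
    {φ ψ : ℝ → ℝ} (hφ : MonotoneOn φ A' ∨ AntitoneOn φ A') (hA : MapsTo φ A' A)
    (hψ : MonotoneOn ψ B' ∨ AntitoneOn ψ B') (hB : MapsTo ψ B' B) :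
    HardyVariationOn (fun p => g (φ p.1, ψ p.2)) A' B' := by
  refine ⟨?_, fun σ hσ => ?_, fun τ hτ => ?_⟩
  · let r : VariationSpace B → VariationSpace B' := fun k t => k (ψ t)
    have hl : LipschitzWith 1 r := by
      intro k k'
      rw [ENNReal.coe_one, one_mul]
      exact eVariationOn_comp_le (fun t => k t - k' t : ℝ → ℝ) hψ hB
    exact hl.comp_boundedVariationOn (g := sectionMap g B ∘ φ)
      (ne_top_of_le_ne_top h.mixed (eVariationOn_comp_le _ hφ hA))
  · exact ne_top_of_le_ne_top (h.fst _ (hA hσ)) (eVariationOn_comp_le _ hψ hB)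
  · exact ne_top_of_le_ne_top (h.snd _ (hB hτ)) (eVariationOn_comp_le _ hφ hA)

/-- The variation from `s` to the right end dominates the increments of a function. -/
theorem exists_antitoneOn_edist_le {E : Type*} [PseudoEMetricSpace E] {f : ℝ → E} {a b : ℝ}
    (hf : BoundedVariationOn f (Icc a b)) :
    ∃ w : ℝ → ℝ, AntitoneOn w (Icc a b) ∧
      (∀ x ∈ Icc a b, w x - w b ≤ (eVariationOn f (Icc a b)).toReal) ∧
      ∀ x ∈ Icc a b, ∀ y ∈ Icc a b, x ≤ y →
        edist (f x) (f y) ≤ ENNReal.ofReal (w x - w y) := by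
  have hfin : ∀ x ∈ Icc a b, eVariationOn f (Icc x b) ≠ ⊤ := fun x hx =>
    ne_top_of_le_ne_top hf (eVariationOn.mono f (Icc_subset_Icc_left hx.1))
  refine ⟨fun x => (eVariationOn f (Icc x b)).toReal, ?_, ?_, ?_⟩
  · intro x hx y hy hxy
    exact ENNReal.toReal_mono (hfin x hx) (eVariationOn.mono f (Icc_subset_Icc_left hxy))
  · intro x hx
    have h1 := ENNReal.toReal_mono hf (eVariationOn.mono f (Icc_subset_Icc_left hx.1))
    have h2 : 0 ≤ (eVariationOn f (Icc b b)).toReal := ENNReal.toReal_nonneg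
    linarith
  · intro x hx y hy hxy
    have h := eVariationOn.Icc_add_Icc f hxy hy.2 (mem_univ y)
    simp only [univ_inter] at h
    have h1 : eVariationOn f (Icc x y) =
        ENNReal.ofReal ((eVariationOn f (Icc x b)).toReal - (eVariationOn f (Icc y b)).toReal) := by
      rw [ENNReal.ofReal_sub _ ENNReal.toReal_nonneg, ENNReal.ofReal_toReal (hfin x hx),
        ENNReal.ofReal_toReal (hfin y hy), ← h, ENNReal.add_sub_cancel_right (hfin y hy)]
    rw [← h1]
    exact eVariationOn.edist_le f (left_mem_Icc.2 hxy) (right_mem_Icc.2 hxy)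

theorem abs_sub_le_of_edist_le {x y c : ℝ} (hc : 0 ≤ c) (h : edist x y ≤ ENNReal.ofReal c) :
    |x - y| ≤ c := by
  rwa [edist_dist, Real.dist_eq, ENNReal.ofReal_le_ofReal_iff hc] at h

/-- One antitone function dominates the increments of all sections, and the variations of the
differences of sections. -/
theorem HardyVariationOn.exists_dominating {g : ℝ × ℝ → ℝ} {a₁ b₁ a₂ b₂ : ℝ} (h₂ : a₂ ≤ b₂)
    (h : HardyVariationOn g (Icc a₁ b₁) (Icc a₂ b₂)) :
    ∃ w : ℝ → ℝ, AntitoneOn w (Icc a₁ b₁) ∧ ∀ x ∈ Icc a₁ b₁, ∀ y ∈ Icc a₁ b₁, x ≤ y →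
      (∀ t ∈ Icc a₂ b₂, |g (x, t) - g (y, t)| ≤ w x - w y) ∧
      eVariationOn (fun t => g (x, t) - g (y, t)) (Icc a₂ b₂) ≤ ENNReal.ofReal (w x - w y) := by
  obtain ⟨w₁, hw₁, -, h₁⟩ := exists_antitoneOn_edist_le (f := sectionMap g (Icc a₂ b₂)) h.mixed
  have hb : b₂ ∈ Icc a₂ b₂ := right_mem_Icc.2 h₂
  obtain ⟨w₂, hw₂, -, h₂⟩ := exists_antitoneOn_edist_le (h.snd b₂ hb)
  -- `w₂` controls the difference of two sections at the end `b₂`, and `w₁` its variation from `t`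
  -- to `b₂`.
  refine ⟨fun x => w₁ x + w₂ x, fun x hx y hy hxy => add_le_add (hw₁ hx hy hxy) (hw₂ hx hy hxy),
    fun x hx y hy hxy => ?_⟩
  have e1 := h₁ x hx y hy hxy
  have n1 := sub_nonneg.2 (hw₁ hx hy hxy)
  have n2 := sub_nonneg.2 (hw₂ hx hy hxy)
  have e2 := abs_sub_le_of_edist_le n2 (h₂ x hx y hy hxy)
  rw [edist_sectionMap] at e1
  refine ⟨fun t ht => ?_, e1.trans (ENNReal.ofReal_le_ofReal (by linarith))⟩
  have e3 := abs_sub_le_of_edist_le n1 ((eVariationOn.edist_le (fun t => g (x, t) - g (y, t))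
    ht hb).trans e1)
  rw [abs_le] at *
  constructor <;> linarith [e2.1, e2.2, e3.1, e3.2]

theorem BoundedVariationOn.abs_integral_mul_le {f φ : ℝ → ℝ} {a b K : ℝ} (hab : a < b)
    (hf : BoundedVariationOn f (Icc a b)) (hφ : IntegrableOn φ (Ioc a b))
    (hK : ∀ c ∈ Icc a b, |∫ x in a..c, φ x| ≤ K) :
    IntegrableOn (fun x => f x * φ x) (Ioc a b) ∧
      |∫ x in a..b, f x * φ x| ≤ K * (|f b| + 2 * (eVariationOn f (Icc a b)).toReal) := by
  obtain ⟨w, hw, hW, h⟩ := exists_antitoneOn_edist_le hf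
  exact abs_integral_mul_le_of_dominated hab
    (fun x hx y hy hxy => abs_sub_le_of_edist_le
      (sub_nonneg.2 (hw (Ioc_subset_Icc_self hx) (Ioc_subset_Icc_self hy) hxy))
      (h x (Ioc_subset_Icc_self hx) y (Ioc_subset_Icc_self hy) hxy))
    (fun x hx => hW x (Ioc_subset_Icc_self hx)) hφ hK

theorem BoundedVariationOn.exists_tendsto_nhdsGT_zero {f : ℝ → ℝ} {ε : ℝ} (hε : 0 < ε)
    (hf : BoundedVariationOn f (Icc 0 ε)) : ∃ l, Tendsto f (𝓝[>] 0) (𝓝 l) := by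
  obtain ⟨l, hl⟩ := hf.exists_tendsto_right 0
  refine ⟨l, ?_⟩
  have : Icc 0 ε ∩ Ioi 0 = Ioc 0 ε := by
    ext x
    simp only [mem_inter_iff, mem_Icc, mem_Ioi, mem_Ioc]
    exact ⟨fun h => ⟨h.2, h.1.2⟩, fun h => ⟨⟨h.1.le, h.2⟩, h.1⟩⟩
  rwa [this, nhdsWithin_Ioc_eq_nhdsGT hε] at hl

/-- The Dirichlet–Jordan theorem at the left end of an interval. -/
theorem BoundedVariationOn.tendsto_integral_mul_dirichletKer {f : ℝ → ℝ} {ε l : ℝ} (hε : 0 < ε)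
    (hf : BoundedVariationOn f (Icc 0 ε)) (hl : Tendsto f (𝓝[>] 0) (𝓝 l)) :
    Tendsto (fun N : ℝ => ∫ t in 0..ε, f t * dirichletKer N t) atTop (𝓝 (Real.pi / 2 * l)) := by
  obtain ⟨w, hw, -, h⟩ := exists_antitoneOn_edist_le hf
  have h1 := QFT.tendsto_integral_mul_dirichletKer (ι := Unit) (l := pure ()) (k := fun _ => f)
    (w := w) (κ := f) hε hw
    (fun _ x hx y hy hxy => abs_sub_le_of_edist_le (sub_nonneg.2 (hw hx hy hxy)) (h x hx y hy hxy))
    (fun δ _ => tendsto_const_nhds) hl tendsto_sineIntegral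
  have h2 : Tendsto (fun N : ℝ => ((), N)) atTop (pure () ×ˢ atTop) :=
    tendsto_const_pure.prodMk tendsto_id
  exact h1.comp h2

/-! ### Dirichlet–Jordan theorem at the corner of a rectangle. -/

section Corner

variable {g : ℝ × ℝ → ℝ} {ε₁ ε₂ : ℝ}

/-- Existence of the double limit at the corner of a rectangle. -/
theorem HardyVariationOn.exists_tendsto (h₁ : 0 < ε₁) (h₂ : 0 < ε₂)
    (h : HardyVariationOn g (Icc 0 ε₁) (Icc 0 ε₂)) :
    ∃ ℓ, Tendsto g (𝓝[>] 0 ×ˢ 𝓝[>] 0) (𝓝 ℓ) := by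
  obtain ⟨w, hw, hdom⟩ := h.exists_dominating h₂.le
  refine cauchy_map_iff_exists_tendsto.1 ?_
  rw [Metric.cauchy_iff]
  refine ⟨inferInstance, fun r hr => ?_⟩
  obtain ⟨δ, hδ, hosc⟩ := exists_forall_antitoneOn_sub_le h₁ hw (show 0 < r / 4 by positivity)
  have hosc' := hosc δ ⟨hδ.1, le_rfl⟩
  have hδm : δ ∈ Icc 0 ε₁ := Ioo_subset_Icc_self hδ
  obtain ⟨l, hl⟩ := BoundedVariationOn.exists_tendsto_nhdsGT_zero h₂ (h.fst δ hδm)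
  have hev : {t | |g (δ, t) - l| < r / 8} ∈ 𝓝[>] (0 : ℝ) := by
    have := Metric.tendsto_nhds.1 hl (r / 8) (by positivity)
    simp only [Real.dist_eq] at this
    exact this
  have hA : Ioc 0 δ ∈ 𝓝[>] (0 : ℝ) := Ioc_mem_nhdsGT hδ.1
  have hB : Ioc 0 ε₂ ∈ 𝓝[>] (0 : ℝ) := Ioc_mem_nhdsGT h₂
  refine ⟨_, image_mem_map (prod_mem_prod hA (inter_mem hev hB)), ?_⟩
  -- `r / 4` for replacing the section at `s` by the one at `δ`, uniformly in `t`, and `r / 8` for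
  -- the limit along that section.
  have key : ∀ p ∈ Ioc 0 δ ×ˢ ({t | |g (δ, t) - l| < r / 8} ∩ Ioc 0 ε₂), |g p - l| < 3 * r / 8 := by
    rintro ⟨s, t⟩ ⟨hs, ht, ht'⟩
    have h1 := ((hdom s ⟨hs.1.le, hs.2.trans hδm.2⟩ δ hδm hs.2).1 t
      (Ioc_subset_Icc_self ht')).trans (hosc' s hs)
    have h2 : |g (δ, t) - l| < r / 8 := ht
    rw [abs_le] at h1
    rw [abs_lt] at *
    constructor <;> linarith [h1.1, h1.2, h2.1, h2.2]
  rintro _ ⟨p, hp, rfl⟩ _ ⟨q, hq, rfl⟩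
  have h1 := abs_lt.1 (key p hp)
  have h2 := abs_lt.1 (key q hq)
  rw [Real.dist_eq, abs_lt]
  constructor <;> linarith [h1.1, h1.2, h2.1, h2.2]

/-- For fixed small `s`, letting `t` tend to 0 preserves the non-strict estimate given by the double
limit. -/
theorem tendsto_of_tendsto_prod_of_forall {κ : ℝ → ℝ} {ℓ : ℝ} (h₁ : 0 < ε₁)
    (hg : Tendsto g (𝓝[>] 0 ×ˢ 𝓝[>] 0) (𝓝 ℓ))
    (hκ : ∀ s ∈ Ioc 0 ε₁, Tendsto (fun t => g (s, t)) (𝓝[>] 0) (𝓝 (κ s))) :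
    Tendsto κ (𝓝[>] 0) (𝓝 ℓ) := by
  rw [Metric.tendsto_nhds]
  intro e he
  have h1 := (Metric.tendsto_nhds.1 hg (e / 2) (by positivity)).curry
  filter_upwards [h1, Ioc_mem_nhdsGT h₁] with s hs hs'
  have h2 : dist (κ s) ℓ ≤ e / 2 :=
    le_of_tendsto ((hκ s hs').dist tendsto_const_nhds) (hs.mono fun t ht => ht.le)
  linarith

/-- The Dirichlet–Jordan theorem at the corner of a rectangle. -/
theorem HardyVariationOn.tendsto_integral {ℓ : ℝ} (h₁ : 0 < ε₁) (h₂ : 0 < ε₂)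
    (h : HardyVariationOn g (Icc 0 ε₁) (Icc 0 ε₂))
    (hg : Tendsto g (𝓝[>] 0 ×ˢ 𝓝[>] 0) (𝓝 ℓ)) :
    Tendsto (fun q : ℝ × ℝ => ∫ s in 0..ε₁, (∫ t in 0..ε₂, g (s, t) * dirichletKer q.1 t) *
      dirichletKer q.2 s) (atTop ×ˢ atTop) (𝓝 ((Real.pi / 2) ^ 2 * ℓ)) := by
  obtain ⟨K, hK0, hK⟩ := exists_abs_sineIntegral_le
  obtain ⟨w, hw, hdom⟩ := h.exists_dominating h₂.le
  have hφ : ∀ N, IntegrableOn (dirichletKer N) (Ioc 0 ε₂) := fun N =>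
    ((continuous_dirichletKer N).integrableOn_Icc).mono_set Ioc_subset_Icc_self
  have hφK : ∀ N, ∀ c ∈ Icc 0 ε₂, |∫ x in 0..c, dirichletKer N x| ≤ K := fun N c _ => by
    rw [integral_dirichletKer, mul_zero, sineIntegral_zero, sub_zero]; exact hK _
  have hex : ∀ s, ∃ l, s ∈ Ioc 0 ε₁ → Tendsto (fun t => g (s, t)) (𝓝[>] 0) (𝓝 l) := by
    intro s
    by_cases hs : s ∈ Ioc 0 ε₁
    · obtain ⟨l, hl⟩ := BoundedVariationOn.exists_tendsto_nhdsGT_zero h₂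
        (h.fst s (Ioc_subset_Icc_self hs))
      exact ⟨l, fun _ => hl⟩
    · exact ⟨0, fun h => absurd h hs⟩
  choose κ hκ using hex
  have hint : ∀ N, ∀ s ∈ Icc 0 ε₁,
      IntervalIntegrable (fun t => g (s, t) * dirichletKer N t) volume 0 ε₂ := fun N s hs =>
    (intervalIntegrable_iff_integrableOn_Ioc_of_le h₂.le).2
      (BoundedVariationOn.abs_integral_mul_le h₂ (h.fst s hs) (hφ N) (hφK N)).1
  -- The inner integrals form a family indexed by `N`. By the mean value estimate their increments
  -- are at most `K` times one pointwise difference plus twice a variation, each at most `w x - w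
  -- y`: hence `3 * K * w`, independent of `N`.
  have h3 := tendsto_integral_mul_dirichletKer (l := atTop)
    (k := fun N s => ∫ t in 0..ε₂, g (s, t) * dirichletKer N t) (w := fun s => 3 * K * w s)
    (κ := fun s => Real.pi / 2 * κ s) (ℓ := Real.pi / 2 * ℓ) h₁
    (fun x hx y hy hxy => mul_le_mul_of_nonneg_left (hw hx hy hxy) (by positivity))
    (by
      intro N x hx y hy hxy
      obtain ⟨hd, hv⟩ := hdom x hx y hy hxy
      have hbv : BoundedVariationOn (fun t => g (x, t) - g (y, t)) (Icc 0 ε₂) :=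
        ne_top_of_le_ne_top ENNReal.ofReal_ne_top hv
      have hw0 := sub_nonneg.2 (hw hx hy hxy)
      have hb := (BoundedVariationOn.abs_integral_mul_le h₂ hbv (hφ N) (hφK N)).2
      have hv' := ENNReal.toReal_le_of_le_ofReal hw0 hv
      have he := hd ε₂ (right_mem_Icc.2 h₂.le)
      rw [← intervalIntegral.integral_sub (hint N x hx) (hint N y hy)]
      simp_rw [← sub_mul]
      refine hb.trans ?_
      calc K * (|g (x, ε₂) - g (y, ε₂)| +
            2 * (eVariationOn (fun t => g (x, t) - g (y, t)) (Icc 0 ε₂)).toReal)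
          ≤ K * ((w x - w y) + 2 * (w x - w y)) := by gcongr
        _ = 3 * K * w x - 3 * K * w y := by ring)
    (fun δ hδ => BoundedVariationOn.tendsto_integral_mul_dirichletKer h₂
      (h.fst δ (Ioc_subset_Icc_self hδ)) (hκ δ hδ))
    ((tendsto_of_tendsto_prod_of_forall h₁ hg hκ).const_mul _) tendsto_sineIntegral
  convert h3 using 2
  ring

end Corner

/-! ### Folding the plane onto a quadrant. -/

/-- Folding an integral along a measure-preserving map that exchanges a set with its complement. -/
theorem integral_eq_setIntegral_add_comp {α E : Type*} [MeasurableSpace α] [NormedAddCommGroup E]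
    [NormedSpace ℝ E] {μ : Measure α} {e : α ≃ᵐ α} (he : MeasurePreserving e μ μ) {s : Set α}
    (hs : MeasurableSet s) (hes : e ⁻¹' sᶜ =ᵐ[μ] s) {H : α → E} (hH : Integrable H μ) :
    ∫ x, H x ∂μ = ∫ x in s, (H x + H (e x)) ∂μ := by
  have hHe : Integrable (fun x => H (e x)) μ :=
    (he.integrable_comp_emb e.measurableEmbedding).2 hH
  have h := setIntegral_congr_set (f := fun x => H (e x)) hes
  rw [he.setIntegral_preimage_emb e.measurableEmbedding] at h
  rw [integral_add hH.integrableOn hHe.integrableOn, ← h, integral_add_compl hs hH]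

/-- The sum of a function over the reflections in the coordinate axes. -/
def reflectionSum {E : Type*} [Add E] (G : ℝ × ℝ → E) (p : ℝ × ℝ) : E :=
  G (-p.1, -p.2) + G (p.1, p.2) + G (-p.1, p.2) + G (p.1, -p.2)

theorem ae_eq_Iio_Iic_prod (ν : Measure ℝ) [SFinite ν] :
    {p : ℝ × ℝ | p.1 ≤ 0} =ᵐ[(volume : Measure ℝ).prod ν] {p | p.1 < 0} := by
  have h : ∀ᵐ p : ℝ × ℝ ∂((volume : Measure ℝ).prod ν), p.1 ≠ 0 :=
    Measure.quasiMeasurePreserving_fst.ae (Measure.ae_ne volume 0)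
  filter_upwards [h] with p hp
  exact propext ⟨fun h => lt_of_le_of_ne h hp, le_of_lt⟩

/-- The measure `ν` is left general so that, after a swap, the other variable can be folded when the
first already runs over a half-line. -/
theorem integral_prod_fold_fst {ν : Measure ℝ} [SFinite ν] {H : ℝ × ℝ → ℝ}
    (hH : Integrable H ((volume : Measure ℝ).prod ν)) :
    ∫ p, H p ∂((volume : Measure ℝ).prod ν) =
      ∫ p, (H p + H (-p.1, p.2)) ∂((volume.restrict (Ioi (0 : ℝ))).prod ν) := by
  let e : ℝ × ℝ ≃ᵐ ℝ × ℝ := (MeasurableEquiv.neg ℝ).prodCongr (MeasurableEquiv.refl ℝ)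
  have he : MeasurePreserving e ((volume : Measure ℝ).prod ν) ((volume : Measure ℝ).prod ν) :=
    (Measure.measurePreserving_neg (volume : Measure ℝ)).prod (MeasurePreserving.id ν)
  have hrestr : ((volume : Measure ℝ).restrict (Ioi 0)).prod ν =
      ((volume : Measure ℝ).prod ν).restrict {p | 0 < p.1} := by
    rw [← Measure.restrict_univ (μ := ν), Measure.prod_restrict, Measure.restrict_univ]
    congr 1
    ext p
    simp
  rw [hrestr]
  refine integral_eq_setIntegral_add_comp he (measurableSet_lt measurable_const measurable_fst)
    ?_ hH
  have h2 := he.quasiMeasurePreserving.preimage_ae_eq (ae_eq_Iio_Iic_prod ν)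
  have h3 : {p : ℝ × ℝ | 0 < p.1}ᶜ = {p | p.1 ≤ 0} := by
    ext p
    simp
  have h4 : e ⁻¹' {p : ℝ × ℝ | p.1 < 0} = {p | 0 < p.1} := by
    ext p
    simp [e, MeasurableEquiv.prodCongr]
  rwa [h4, ← h3] at h2

theorem integral_eq_setIntegral_reflectionSum {H : ℝ × ℝ → ℝ} (hH : Integrable H) :
    ∫ p, H p = ∫ p in Ioi (0 : ℝ) ×ˢ Ioi (0 : ℝ), reflectionSum H p := by
  set μ := (volume : Measure ℝ).restrict (Ioi 0) with hμ
  have h1 : Integrable (fun p : ℝ × ℝ => H p + H (-p.1, p.2)) (μ.prod volume) := by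
    have hm : MeasurePreserving (fun p : ℝ × ℝ => (-p.1, p.2))
        ((volume : Measure ℝ).prod volume) ((volume : Measure ℝ).prod volume) :=
      (Measure.measurePreserving_neg (volume : Measure ℝ)).prod (MeasurePreserving.id volume)
    have h := hH.add (hm.integrable_comp_of_integrable hH)
    refine h.mono_measure ?_
    rw [Measure.volume_eq_prod]
    exact Measure.prod_mono Measure.restrict_le_self le_rfl
  have h2 : Integrable (fun p : ℝ × ℝ => H p.swap + H (-p.swap.1, p.swap.2))
      ((volume : Measure ℝ).prod μ) := h1.swap
  rw [Measure.volume_eq_prod, integral_prod_fold_fst hH, ← integral_prod_swap,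
    integral_prod_fold_fst h2, ← integral_prod_swap, ← Measure.prod_restrict]
  refine integral_congr_ae (ae_of_all _ fun p => ?_)
  simp only [Prod.swap, reflectionSum]
  ring

theorem integrable_mul_dirichletKer_mul {μ : Measure (ℝ × ℝ)} {F : ℝ × ℝ → ℝ}
    (hF : Integrable F μ) (M N : ℝ) :
    Integrable (fun p => F p * (dirichletKer M p.1 * dirichletKer N p.2)) μ := by
  refine hF.mul_bdd (c := |M| * |N|) ?_ (ae_of_all _ fun p => ?_)
  · exact (((continuous_dirichletKer M).comp continuous_fst).mul
      ((continuous_dirichletKer N).comp continuous_snd)).aestronglyMeasurable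
  · rw [Real.norm_eq_abs, abs_mul]
    exact mul_le_mul (abs_dirichletKer_le _ _) (abs_dirichletKer_le _ _) (abs_nonneg _)
      (abs_nonneg _)

theorem integrable_reflectionSum {G : ℝ × ℝ → ℝ} (hG : Integrable G) :
    Integrable (fun p : ℝ × ℝ => G (-p.1, -p.2)) ∧ Integrable (fun p : ℝ × ℝ => G (-p.1, p.2)) ∧
      Integrable (fun p : ℝ × ℝ => G (p.1, -p.2)) := by
  have hn := Measure.measurePreserving_neg (volume : Measure ℝ)
  have hi := MeasurePreserving.id (volume : Measure ℝ)
  exact ⟨(hn.prod hn).integrable_comp_of_integrable hG,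
    (hn.prod hi).integrable_comp_of_integrable hG, (hi.prod hn).integrable_comp_of_integrable hG⟩

/-! ### Contributions away from the corner. -/

section Tails

variable {S : ℝ × ℝ → ℝ} {ε₁ ε₂ : ℝ}

/-- The contribution of the region away from both axes vanishes in the limit. -/
theorem tendsto_setIntegral_Ioi_Ioi (h₁ : 0 < ε₁) (h₂ : 0 < ε₂) (hS : Integrable S) :
    Tendsto (fun q : ℝ × ℝ => ∫ p in Ioi ε₁ ×ˢ Ioi ε₂,
      S p * (dirichletKer q.2 p.1 * dirichletKer q.1 p.2)) (atTop ×ˢ atTop) (𝓝 0) := by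
  have hm : MeasurableSet (Ioi ε₁ ×ˢ Ioi ε₂) := measurableSet_Ioi.prod measurableSet_Ioi
  have hF : Integrable ((Ioi ε₁ ×ˢ Ioi ε₂).indicator fun p => S p * (p.1⁻¹ * p.2⁻¹)) := by
    rw [integrable_indicator_iff hm]
    refine hS.integrableOn.mul_bdd (c := ε₁⁻¹ * ε₂⁻¹)
      (Measurable.aestronglyMeasurable (by fun_prop)) ?_
    filter_upwards [ae_restrict_mem hm] with p hp
    have hp1 : ε₁ < p.1 := hp.1
    have hp2 : ε₂ < p.2 := hp.2
    rw [norm_mul, norm_inv, norm_inv, Real.norm_of_nonneg (h₁.trans hp1).le,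
      Real.norm_of_nonneg (h₂.trans hp2).le]
    exact mul_le_mul (inv_anti₀ h₁ hp1.le) (inv_anti₀ h₂ hp2.le)
      (inv_nonneg.2 (h₂.trans hp2).le) (inv_nonneg.2 h₁.le)
  refine (tendsto_integral_mul_sin_mul_sin hF).congr fun q => ?_
  rw [← integral_indicator hm]
  refine integral_congr_ae (ae_of_all _ fun p => ?_)
  by_cases hp : p ∈ Ioi ε₁ ×ˢ Ioi ε₂
  · have hp1 : p.1 ≠ 0 := (h₁.trans hp.1).ne'
    have hp2 : p.2 ≠ 0 := (h₂.trans hp.2).ne'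
    simp only [indicator_of_mem hp, dirichletKer_of_ne_zero _ hp1, dirichletKer_of_ne_zero _ hp2]
    ring
  · simp [indicator_of_notMem hp]

/-- The contribution of the region near one axis only vanishes in the limit, when the difference
quotients with respect to one section are integrable there. -/
theorem tendsto_setIntegral_Ioc_Ioi (h₁ : 0 < ε₁) (h₂ : 0 < ε₂) (hS : Integrable S) {c : ℝ → ℝ}
    (hc : Integrable c)
    (hLC : ∫⁻ t in Ioi ε₂, ∫⁻ s in Ioc 0 ε₁, ‖s⁻¹ * (S (s, t) - c t)‖ₑ < ⊤) :
    Tendsto (fun q : ℝ × ℝ => ∫ p in Ioc 0 ε₁ ×ˢ Ioi ε₂,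
      S p * (dirichletKer q.2 p.1 * dirichletKer q.1 p.2)) (atTop ×ˢ atTop) (𝓝 0) := by
  obtain ⟨K, hK0, hK⟩ := exists_abs_sineIntegral_le
  set R := Ioc 0 ε₁ ×ˢ Ioi ε₂ with hR
  have hm : MeasurableSet R := measurableSet_Ioc.prod measurableSet_Ioi
  have hvol : (volume : Measure (ℝ × ℝ)).restrict R =
      (volume.restrict (Ioc 0 ε₁)).prod (volume.restrict (Ioi ε₂)) := by
    rw [Measure.prod_restrict, Measure.volume_eq_prod]
  -- Write `S = (S - c) + c` on the strip. LC makes the first part integrable after division by the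
  -- small variable; dividing by the other one, at least `ε₂`, is harmless.
  have hQ : IntegrableOn (fun p : ℝ × ℝ => p.1⁻¹ * (S p - c p.2)) R := by
    have hmeas : AEStronglyMeasurable (fun p : ℝ × ℝ => p.1⁻¹ * (S p - c p.2))
        (volume.restrict R) := by
      refine (Measurable.aestronglyMeasurable (by fun_prop)).mul
        (hS.aestronglyMeasurable.restrict.sub ?_)
      rw [hvol]
      exact hc.aestronglyMeasurable.restrict.comp_snd
    refine ⟨hmeas, ?_⟩
    rw [hvol] at hmeas
    rw [HasFiniteIntegral, hvol, lintegral_prod_symm _ hmeas.enorm]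
    exact hLC
  have hF : Integrable (R.indicator fun p => p.1⁻¹ * (S p - c p.2) * p.2⁻¹) := by
    rw [integrable_indicator_iff hm]
    refine hQ.mul_bdd (c := ε₂⁻¹) (Measurable.aestronglyMeasurable (by fun_prop)) ?_
    filter_upwards [ae_restrict_mem hm] with p hp
    have hp2 : ε₂ < p.2 := hp.2
    rw [norm_inv, Real.norm_of_nonneg (h₂.trans hp2).le]
    gcongr
  have hC : Integrable ((Ioi ε₂).indicator fun t => c t * t⁻¹) := by
    rw [integrable_indicator_iff measurableSet_Ioi]
    refine hc.integrableOn.mul_bdd (c := ε₂⁻¹) (Measurable.aestronglyMeasurable (by fun_prop)) ?_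
    filter_upwards [ae_restrict_mem measurableSet_Ioi] with t ht
    have ht2 : ε₂ < t := ht
    rw [norm_inv, Real.norm_of_nonneg (h₂.trans ht2).le]
    gcongr
  have hlim1 := tendsto_integral_mul_sin_mul_sin hF
  -- The part `c` depends on `t` alone, so its integral factors into a bounded sine integral and a
  -- vanishing sine transform.
  have hlim2 : Tendsto (fun q : ℝ × ℝ => sineIntegral (q.2 * ε₁) *
      ∫ t, (Ioi ε₂).indicator (fun t => c t * t⁻¹) t * Real.sin (q.1 * t))
      (atTop ×ˢ atTop) (𝓝 0) := by
    refine isBoundedUnder_le_mul_tendsto_zero ?_ ((tendsto_integral_mul_sin hC).comp tendsto_fst)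
    exact isBoundedUnder_of ⟨K, fun q => hK _⟩
  have hlim := hlim1.add hlim2
  rw [add_zero] at hlim
  refine hlim.congr fun q => ?_
  have hcm : Integrable (fun p : ℝ × ℝ => dirichletKer q.2 p.1 *
      (c p.2 * dirichletKer q.1 p.2)) (volume.restrict R) := by
    rw [hvol]
    refine Integrable.mul_prod (f := dirichletKer q.2) (g := fun t => c t * dirichletKer q.1 t) ?_ ?_
    · exact ((continuous_dirichletKer _).integrableOn_Icc).mono_set Ioc_subset_Icc_self
    · exact hc.integrableOn.mul_bdd (c := |q.1|) (continuous_dirichletKer _).aestronglyMeasurable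
        (ae_of_all _ fun t => abs_dirichletKer_le _ _)
  have hsm := integrable_mul_dirichletKer_mul (hS.integrableOn (s := R)) q.2 q.1
  have e1 : ∫ p, R.indicator (fun p => p.1⁻¹ * (S p - c p.2) * p.2⁻¹) p *
      (Real.sin (q.2 * p.1) * Real.sin (q.1 * p.2)) =
      ∫ p in R, (S p * (dirichletKer q.2 p.1 * dirichletKer q.1 p.2) -
        dirichletKer q.2 p.1 * (c p.2 * dirichletKer q.1 p.2)) := by
    rw [← integral_indicator hm]
    refine integral_congr_ae (ae_of_all _ fun p => ?_)
    by_cases hp : p ∈ R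
    · have hp1 : p.1 ≠ 0 := hp.1.1.ne'
      have hp2 : p.2 ≠ 0 := (h₂.trans hp.2).ne'
      simp only [indicator_of_mem hp, dirichletKer_of_ne_zero _ hp1, dirichletKer_of_ne_zero _ hp2]
      ring
    · simp [indicator_of_notMem hp]
  have e2 : sineIntegral (q.2 * ε₁) *
      ∫ t, (Ioi ε₂).indicator (fun t => c t * t⁻¹) t * Real.sin (q.1 * t) =
      ∫ p in R, dirichletKer q.2 p.1 * (c p.2 * dirichletKer q.1 p.2) := by
    rw [hvol, integral_prod_mul (f := dirichletKer q.2) (g := fun t => c t * dirichletKer q.1 t),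
      ← intervalIntegral.integral_of_le h₁.le, integral_dirichletKer, mul_zero, sineIntegral_zero,
      sub_zero, ← integral_indicator measurableSet_Ioi]
    congr 1
    refine integral_congr_ae (ae_of_all _ fun t => ?_)
    by_cases ht : t ∈ Ioi ε₂
    · have ht2 : t ≠ 0 := (h₂.trans ht).ne'
      simp only [indicator_of_mem ht, dirichletKer_of_ne_zero _ ht2]
      ring
    · simp [indicator_of_notMem ht]
  rw [e1, e2, integral_sub hsm hcm]
  ring

theorem tendsto_setIntegral_Ioi_Ioc (h₁ : 0 < ε₁) (h₂ : 0 < ε₂) (hS : Integrable S) {c : ℝ → ℝ}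
    (hc : Integrable c)
    (hLC : ∫⁻ s in Ioi ε₁, ∫⁻ t in Ioc 0 ε₂, ‖t⁻¹ * (S (s, t) - c s)‖ₑ < ⊤) :
    Tendsto (fun q : ℝ × ℝ => ∫ p in Ioi ε₁ ×ˢ Ioc 0 ε₂,
      S p * (dirichletKer q.2 p.1 * dirichletKer q.1 p.2)) (atTop ×ˢ atTop) (𝓝 0) := by
  have h := tendsto_setIntegral_Ioc_Ioi (S := fun p => S p.swap) h₂ h₁ hS.swap hc hLC
  refine (h.comp (tendsto_snd.prodMk tendsto_fst)).congr fun q => ?_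
  have hmp : MeasurePreserving (MeasurableEquiv.prodComm : ℝ × ℝ ≃ᵐ ℝ × ℝ) volume volume :=
    Measure.measurePreserving_swap
  have := hmp.setIntegral_preimage_emb MeasurableEquiv.prodComm.measurableEmbedding
    (fun p => S p * (dirichletKer q.2 p.1 * dirichletKer q.1 p.2)) (Ioi ε₁ ×ˢ Ioc 0 ε₂)
  rw [← this]
  simp only [Function.comp_apply]
  have hset : (MeasurableEquiv.prodComm : ℝ × ℝ ≃ᵐ ℝ × ℝ) ⁻¹' (Ioi ε₁ ×ˢ Ioc 0 ε₂) =
      Ioc 0 ε₂ ×ˢ Ioi ε₁ := by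
    ext p
    simp [MeasurableEquiv.prodComm, and_comm]
  rw [hset]
  refine integral_congr_ae (ae_of_all _ fun p => ?_)
  simp only [MeasurableEquiv.prodComm, MeasurableEquiv.coe_mk, Equiv.prodComm_apply, Prod.fst_swap,
    Prod.snd_swap]
  ring

end Tails

/-- The contribution of the rectangle at the corner, as a double integral. -/
theorem HardyVariationOn.tendsto_setIntegral {g : ℝ × ℝ → ℝ} {ε₁ ε₂ ℓ : ℝ} (h₁ : 0 < ε₁)
    (h₂ : 0 < ε₂) (hgi : Integrable g) (h : HardyVariationOn g (Icc 0 ε₁) (Icc 0 ε₂))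
    (hg : Tendsto g (𝓝[>] 0 ×ˢ 𝓝[>] 0) (𝓝 ℓ)) :
    Tendsto (fun q : ℝ × ℝ => ∫ p in Ioc 0 ε₁ ×ˢ Ioc 0 ε₂,
      g p * (dirichletKer q.2 p.1 * dirichletKer q.1 p.2)) (atTop ×ˢ atTop)
      (𝓝 ((Real.pi / 2) ^ 2 * ℓ)) := by
  refine (h.tendsto_integral h₁ h₂ hg).congr fun q => ?_
  have hi := integrable_mul_dirichletKer_mul
    (hgi.integrableOn (s := Ioc 0 ε₁ ×ˢ Ioc 0 ε₂)) q.2 q.1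
  rw [Measure.volume_eq_prod] at hi ⊢
  rw [setIntegral_prod _ hi, intervalIntegral.integral_of_le h₁.le]
  refine integral_congr_ae (ae_of_all _ fun s => ?_)
  simp only [intervalIntegral.integral_of_le h₂.le]
  rw [← integral_mul_const]
  refine integral_congr_ae (ae_of_all _ fun t => ?_)
  simp only
  ring

theorem setIntegral_Ioi_prod_Ioi {F : ℝ × ℝ → ℝ} {ε₁ ε₂ : ℝ} (h₁ : 0 < ε₁) (h₂ : 0 < ε₂)
    (hF : Integrable F) :
    ∫ p in Ioi (0 : ℝ) ×ˢ Ioi (0 : ℝ), F p =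
      (∫ p in Ioc 0 ε₁ ×ˢ Ioc 0 ε₂, F p) + (∫ p in Ioc 0 ε₁ ×ˢ Ioi ε₂, F p) +
        ((∫ p in Ioi ε₁ ×ˢ Ioc 0 ε₂, F p) + ∫ p in Ioi ε₁ ×ˢ Ioi ε₂, F p) := by
  have hd : ∀ ε : ℝ, Disjoint (Ioc 0 ε) (Ioi ε) := fun ε => Ioc_disjoint_Ioi le_rfl
  have hsplit : ∀ A : Set ℝ, MeasurableSet A → ∫ p in A ×ˢ Ioi (0 : ℝ), F p =
      (∫ p in A ×ˢ Ioc 0 ε₂, F p) + ∫ p in A ×ˢ Ioi ε₂, F p := by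
    intro A hA
    rw [← Ioc_union_Ioi_eq_Ioi h₂.le, prod_union,
      setIntegral_union ((hd ε₂).set_prod_right _ _) (hA.prod measurableSet_Ioi)
        hF.integrableOn hF.integrableOn]
  have hunion : Ioi (0 : ℝ) ×ˢ Ioi (0 : ℝ) = Ioc 0 ε₁ ×ˢ Ioi (0 : ℝ) ∪ Ioi ε₁ ×ˢ Ioi (0 : ℝ) := by
    rw [← union_prod, Ioc_union_Ioi_eq_Ioi h₁.le]
  rw [hunion, setIntegral_union ((hd ε₁).set_prod_left _ _) (measurableSet_Ioi.prod measurableSet_Ioi)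
      hF.integrableOn hF.integrableOn, hsplit _ measurableSet_Ioc, hsplit _ measurableSet_Ioi]

/-- Convergence of the double Dirichlet integral, at the origin. -/
theorem tendsto_integral_mul_dirichletKer_mul {G : ℝ × ℝ → ℝ} {ε₁ ε₂ ℓ₁ ℓ₂ ℓ₃ ℓ₄ : ℝ}
    (h₁ : 0 < ε₁) (h₂ : 0 < ε₂) (hG : Integrable G)
    (hB₁ : HardyVariationOn (fun p => G (-p.1, -p.2)) (Icc 0 ε₁) (Icc 0 ε₂))
    (hB₂ : HardyVariationOn G (Icc 0 ε₁) (Icc 0 ε₂))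
    (hB₃ : HardyVariationOn (fun p => G (-p.1, p.2)) (Icc 0 ε₁) (Icc 0 ε₂))
    (hB₄ : HardyVariationOn (fun p => G (p.1, -p.2)) (Icc 0 ε₁) (Icc 0 ε₂))
    (hℓ₁ : Tendsto (fun p : ℝ × ℝ => G (-p.1, -p.2)) (𝓝[>] 0 ×ˢ 𝓝[>] 0) (𝓝 ℓ₁))
    (hℓ₂ : Tendsto G (𝓝[>] 0 ×ˢ 𝓝[>] 0) (𝓝 ℓ₂))
    (hℓ₃ : Tendsto (fun p : ℝ × ℝ => G (-p.1, p.2)) (𝓝[>] 0 ×ˢ 𝓝[>] 0) (𝓝 ℓ₃))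
    (hℓ₄ : Tendsto (fun p : ℝ × ℝ => G (p.1, -p.2)) (𝓝[>] 0 ×ˢ 𝓝[>] 0) (𝓝 ℓ₄))
    {c d : ℝ → ℝ} (hc : Integrable c) (hd : Integrable d)
    (hLc : ∫⁻ t in Ioi ε₂, ∫⁻ s in Ioc 0 ε₁, ‖s⁻¹ * (reflectionSum G (s, t) - c t)‖ₑ < ⊤)
    (hLd : ∫⁻ s in Ioi ε₁, ∫⁻ t in Ioc 0 ε₂, ‖t⁻¹ * (reflectionSum G (s, t) - d s)‖ₑ < ⊤) :
    Tendsto (fun q : ℝ × ℝ => ∫ p, G p * (dirichletKer q.2 p.1 * dirichletKer q.1 p.2))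
      (atTop ×ˢ atTop) (𝓝 ((Real.pi / 2) ^ 2 * (ℓ₁ + ℓ₂ + ℓ₃ + ℓ₄))) := by
  obtain ⟨hi₁, hi₃, hi₄⟩ := integrable_reflectionSum hG
  have hS : Integrable (reflectionSum G) := ((hi₁.add hG).add hi₃).add hi₄
  have t₁ := hB₁.tendsto_setIntegral h₁ h₂ hi₁ hℓ₁
  have t₂ := hB₂.tendsto_setIntegral h₁ h₂ hG hℓ₂
  have t₃ := hB₃.tendsto_setIntegral h₁ h₂ hi₃ hℓ₃
  have t₄ := hB₄.tendsto_setIntegral h₁ h₂ hi₄ hℓ₄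
  have t := ((((t₁.add t₂).add t₃).add t₄).add (tendsto_setIntegral_Ioc_Ioi h₁ h₂ hS hc hLc)).add
    ((tendsto_setIntegral_Ioi_Ioc h₁ h₂ hS hd hLd).add (tendsto_setIntegral_Ioi_Ioi h₁ h₂ hS))
  have hval : (Real.pi / 2) ^ 2 * ℓ₁ + (Real.pi / 2) ^ 2 * ℓ₂ + (Real.pi / 2) ^ 2 * ℓ₃ +
      (Real.pi / 2) ^ 2 * ℓ₄ + 0 + (0 + 0) = (Real.pi / 2) ^ 2 * (ℓ₁ + ℓ₂ + ℓ₃ + ℓ₄) := by ring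
  rw [hval] at t
  refine t.congr fun q => ?_
  have hI : ∀ {F : ℝ × ℝ → ℝ}, Integrable F → IntegrableOn
      (fun p => F p * (dirichletKer q.2 p.1 * dirichletKer q.1 p.2)) (Ioc 0 ε₁ ×ˢ Ioc 0 ε₂) :=
    fun hF => (integrable_mul_dirichletKer_mul hF q.2 q.1).integrableOn
  rw [integral_eq_setIntegral_reflectionSum (integrable_mul_dirichletKer_mul hG q.2 q.1)]
  have hsym : reflectionSum (fun p => G p * (dirichletKer q.2 p.1 * dirichletKer q.1 p.2)) =
      fun p => reflectionSum G p * (dirichletKer q.2 p.1 * dirichletKer q.1 p.2) := by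
    funext p
    simp only [reflectionSum, dirichletKer_neg]
    ring
  have hexp : (fun p => reflectionSum G p * (dirichletKer q.2 p.1 * dirichletKer q.1 p.2)) =
      fun p => G (-p.1, -p.2) * (dirichletKer q.2 p.1 * dirichletKer q.1 p.2) +
        G p * (dirichletKer q.2 p.1 * dirichletKer q.1 p.2) +
        G (-p.1, p.2) * (dirichletKer q.2 p.1 * dirichletKer q.1 p.2) +
        G (p.1, -p.2) * (dirichletKer q.2 p.1 * dirichletKer q.1 p.2) := by
    funext p
    simp only [reflectionSum]
    ring
  -- Only the corner integral is split into the four reflections; on the strips LC controls just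
  -- their sum.
  have hcorner : ∫ p in Ioc 0 ε₁ ×ˢ Ioc 0 ε₂,
      reflectionSum G p * (dirichletKer q.2 p.1 * dirichletKer q.1 p.2) =
      (∫ p in Ioc 0 ε₁ ×ˢ Ioc 0 ε₂,
        G (-p.1, -p.2) * (dirichletKer q.2 p.1 * dirichletKer q.1 p.2)) +
      (∫ p in Ioc 0 ε₁ ×ˢ Ioc 0 ε₂, G p * (dirichletKer q.2 p.1 * dirichletKer q.1 p.2)) +
      (∫ p in Ioc 0 ε₁ ×ˢ Ioc 0 ε₂,
        G (-p.1, p.2) * (dirichletKer q.2 p.1 * dirichletKer q.1 p.2)) +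
      ∫ p in Ioc 0 ε₁ ×ˢ Ioc 0 ε₂,
        G (p.1, -p.2) * (dirichletKer q.2 p.1 * dirichletKer q.1 p.2) := by
    have i₂ := (hI hi₁).add (hI hG)
    have i₃ := i₂.add (hI hi₃)
    rw [hexp]
    exact (integral_add i₃ (hI hi₄)).trans (congrArg (· + _)
      ((integral_add i₂ (hI hi₃)).trans (congrArg (· + _) (integral_add (hI hi₁) (hI hG)))))
  rw [hsym, setIntegral_Ioi_prod_Ioi h₁ h₂ (integrable_mul_dirichletKer_mul hS q.2 q.1), hcorner]

/-! ### Transfer from the origin to an arbitrary point. -/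

theorem tendsto_sub_nhdsGT (x₀ : ℝ) : Tendsto (fun x => x - x₀) (𝓝[>] x₀) (𝓝[>] 0) := by
  refine tendsto_nhdsWithin_iff.2 ⟨?_, ?_⟩
  · have h : Continuous fun x : ℝ => x - x₀ := by fun_prop
    simpa using (h.tendsto x₀).mono_left nhdsWithin_le_nhds
  · filter_upwards [self_mem_nhdsWithin] with x hx
    have hx' : x₀ < x := hx
    simpa using hx'

theorem tendsto_sub_nhdsLT (x₀ : ℝ) : Tendsto (fun x => x₀ - x) (𝓝[<] x₀) (𝓝[>] 0) := by
  refine tendsto_nhdsWithin_iff.2 ⟨?_, ?_⟩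
  · have h : Continuous fun x : ℝ => x₀ - x := by fun_prop
    simpa using (h.tendsto x₀).mono_left nhdsWithin_le_nhds
  · filter_upwards [self_mem_nhdsWithin] with x hx
    have hx' : x < x₀ := hx
    simpa using hx'

theorem eta_eq_of_tendsto {E : Type*} [NormedAddCommGroup E] [NormedSpace ℝ E] {f : ℝ × ℝ → E}
    {x₀ y₀ : ℝ} {l₁ l₂ l₃ l₄ : E} (h₁ : Tendsto f (𝓝[>] x₀ ×ˢ 𝓝[>] y₀) (𝓝 l₁))
    (h₂ : Tendsto f (𝓝[>] x₀ ×ˢ 𝓝[<] y₀) (𝓝 l₂)) (h₃ : Tendsto f (𝓝[<] x₀ ×ˢ 𝓝[>] y₀) (𝓝 l₃))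
    (h₄ : Tendsto f (𝓝[<] x₀ ×ˢ 𝓝[<] y₀) (𝓝 l₄)) :
    eta f x₀ y₀ = (1 / 4 : ℝ) • (l₁ + l₂ + l₃ + l₄) := by
  rw [eta, h₁.limUnder_eq, h₂.limUnder_eq, h₃.limUnder_eq, h₄.limUnder_eq]

theorem IsBVFIn.hardyVariationOn {g : ℝ × ℝ → ℝ} {x₀ y₀ ε₁ ε₂ : ℝ} (h₁ : 0 < ε₁) (h₂ : 0 < ε₂)
    (h : IsBVFIn g (crossNeighborhood x₀ y₀ ε₁ ε₂)) :
    HardyVariationOn g (Icc (x₀ - ε₁) (x₀ + ε₁)) (Icc (y₀ - ε₂) (y₀ + ε₂)) := by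
  refine IsBVF.hardyVariationOn (by linarith) (by linarith)
    (h _ _ _ _ (by linarith) (by linarith) ?_)
  rintro p ⟨hp, -⟩
  exact Or.inl (abs_le.2 ⟨by linarith [hp.1], by linarith [hp.2]⟩)

/-- Pointwise convergence of the double Dirichlet integral of a real function. -/
theorem quadrantLimitsExist_and_tendsto_integral {g : ℝ × ℝ → ℝ} {x₀ y₀ ε₁ ε₂ : ℝ}
    (h₁ : 0 < ε₁) (h₂ : 0 < ε₂) (hg : Integrable g)
    (hBV : IsBVFIn g (crossNeighborhood x₀ y₀ ε₁ ε₂)) {c d : ℝ → ℝ} (hc : Integrable c)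
    (hd : Integrable d)
    (hLc : ∫⁻ t in Ioi ε₂, ∫⁻ s in Ioc 0 ε₁, ‖s⁻¹ * ((g (x₀ - s, y₀ - t) + g (x₀ + s, y₀ + t) +
      g (x₀ - s, y₀ + t) + g (x₀ + s, y₀ - t)) - c t)‖ₑ < ⊤)
    (hLd : ∫⁻ s in Ioi ε₁, ∫⁻ t in Ioc 0 ε₂, ‖t⁻¹ * ((g (x₀ - s, y₀ - t) + g (x₀ + s, y₀ + t) +
      g (x₀ - s, y₀ + t) + g (x₀ + s, y₀ - t)) - d s)‖ₑ < ⊤) :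
    QuadrantLimitsExist g x₀ y₀ ∧
      Tendsto (fun q : ℝ × ℝ => 1 / Real.pi ^ 2 * ∫ p : ℝ × ℝ,
        g p * (dirichletKer q.2 (x₀ - p.1) * dirichletKer q.1 (y₀ - p.2)))
        (atTop ×ˢ atTop) (𝓝 (eta g x₀ y₀)) := by
  have hH := hBV.hardyVariationOn h₁ h₂
  set G : ℝ × ℝ → ℝ := fun p => g (x₀ + p.1, y₀ + p.2) with hGdef
  have hG : Integrable G := hg.comp_add_left (x₀, y₀)
  have mp : ∀ x ε : ℝ, 0 < ε → MapsTo (fun s => x + s) (Icc 0 ε) (Icc (x - ε) (x + ε)) :=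
    fun x ε hε s hs => ⟨by linarith [hs.1], by linarith [hs.2]⟩
  have mn : ∀ x ε : ℝ, 0 < ε → MapsTo (fun s => x + -s) (Icc 0 ε) (Icc (x - ε) (x + ε)) :=
    fun x ε hε s hs => ⟨by linarith [hs.2], by linarith [hs.1]⟩
  have op : ∀ x ε : ℝ, MonotoneOn (fun s => x + s) (Icc 0 ε) ∨
      AntitoneOn (fun s => x + s) (Icc 0 ε) :=
    fun x ε => Or.inl fun a _ b _ hab => by simpa using hab
  have on : ∀ x ε : ℝ, MonotoneOn (fun s => x + -s) (Icc 0 ε) ∨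
      AntitoneOn (fun s => x + -s) (Icc 0 ε) :=
    fun x ε => Or.inr fun a _ b _ hab => by dsimp only; linarith
  have hB₁ := hH.comp (on x₀ ε₁) (mn x₀ ε₁ h₁) (on y₀ ε₂) (mn y₀ ε₂ h₂)
  have hB₂ := hH.comp (op x₀ ε₁) (mp x₀ ε₁ h₁) (op y₀ ε₂) (mp y₀ ε₂ h₂)
  have hB₃ := hH.comp (on x₀ ε₁) (mn x₀ ε₁ h₁) (op y₀ ε₂) (mp y₀ ε₂ h₂)
  have hB₄ := hH.comp (op x₀ ε₁) (mp x₀ ε₁ h₁) (on y₀ ε₂) (mn y₀ ε₂ h₂)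
  obtain ⟨ℓ₁, hℓ₁⟩ := hB₁.exists_tendsto h₁ h₂
  obtain ⟨ℓ₂, hℓ₂⟩ := hB₂.exists_tendsto h₁ h₂
  obtain ⟨ℓ₃, hℓ₃⟩ := hB₃.exists_tendsto h₁ h₂
  obtain ⟨ℓ₄, hℓ₄⟩ := hB₄.exists_tendsto h₁ h₂
  have q₁ : Tendsto g (𝓝[<] x₀ ×ˢ 𝓝[<] y₀) (𝓝 ℓ₁) :=
    (hℓ₁.comp ((tendsto_sub_nhdsLT x₀).prodMap (tendsto_sub_nhdsLT y₀))).congr fun p => by simp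
  have q₂ : Tendsto g (𝓝[>] x₀ ×ˢ 𝓝[>] y₀) (𝓝 ℓ₂) :=
    (hℓ₂.comp ((tendsto_sub_nhdsGT x₀).prodMap (tendsto_sub_nhdsGT y₀))).congr fun p => by simp
  have q₃ : Tendsto g (𝓝[<] x₀ ×ˢ 𝓝[>] y₀) (𝓝 ℓ₃) :=
    (hℓ₃.comp ((tendsto_sub_nhdsLT x₀).prodMap (tendsto_sub_nhdsGT y₀))).congr fun p => by simp
  have q₄ : Tendsto g (𝓝[>] x₀ ×ˢ 𝓝[<] y₀) (𝓝 ℓ₄) :=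
    (hℓ₄.comp ((tendsto_sub_nhdsGT x₀).prodMap (tendsto_sub_nhdsLT y₀))).congr fun p => by simp
  refine ⟨⟨⟨_, q₂⟩, ⟨_, q₄⟩, ⟨_, q₃⟩, ⟨_, q₁⟩⟩, ?_⟩
  rw [eta_eq_of_tendsto q₂ q₄ q₃ q₁]
  have hmain := (tendsto_integral_mul_dirichletKer_mul h₁ h₂ hG hB₁ hB₂ hB₃ hB₄ hℓ₁ hℓ₂ hℓ₃ hℓ₄
    hc hd (by simpa only [reflectionSum, hGdef, sub_eq_add_neg] using hLc)
    (by simpa only [reflectionSum, hGdef, sub_eq_add_neg] using hLd)).const_mul (1 / Real.pi ^ 2)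
  have hval : 1 / Real.pi ^ 2 * ((Real.pi / 2) ^ 2 * (ℓ₁ + ℓ₂ + ℓ₃ + ℓ₄)) =
      (1 / 4 : ℝ) • (ℓ₂ + ℓ₄ + ℓ₃ + ℓ₁) := by
    rw [smul_eq_mul]
    field_simp
    ring
  rw [hval] at hmain
  refine hmain.congr fun q => ?_
  congr 1
  have htr := integral_add_left_eq_self (μ := (volume : Measure (ℝ × ℝ)))
    (fun p => g p * (dirichletKer q.2 (x₀ - p.1) * dirichletKer q.1 (y₀ - p.2))) (x₀, y₀)
  rw [← htr]
  refine integral_congr_ae (ae_of_all _ fun p => ?_)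
  simp only [hGdef, Prod.fst_add, Prod.snd_add, sub_add_cancel_left, dirichletKer_neg]
  rfl

/-! ### Quaternion exponentials and reduction to the Dirichlet integral. -/

/-- The general formula involves the norm |θ|, which may be replaced by θ since cos x and sin x / x
are even. -/
theorem exp_smul_imaginary {q : ℍ} (hq : q.re = 0) (hn : ‖q‖ = 1) (θ : ℝ) :
    NormedSpace.exp (θ • q) = Real.cos θ • (1 : ℍ) + Real.sin θ • q := by
  rw [Quaternion.exp_of_re_eq_zero _ (by simp [hq]), norm_smul, hn, mul_one, Real.norm_eq_abs,
    Real.cos_abs, smul_smul]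
  congr 1
  · ext <;> simp
  · rcases eq_or_ne θ 0 with rfl | h
    · simp
    · congr 1
      rcases abs_cases θ with ⟨h1, h2⟩ | ⟨h1, h2⟩
      · rw [h1]; field_simp
      · rw [h1, Real.sin_neg]; field_simp

theorem norm_eq_one_of_normSq {q : ℍ} (h : Quaternion.normSq q = 1) : ‖q‖ = 1 := by
  rw [Quaternion.normSq_eq_norm_mul_self, ← sq] at h
  exact (pow_eq_one_iff_of_nonneg (norm_nonneg q) two_ne_zero).1 h

theorem norm_qi : ‖qi‖ = 1 :=
  norm_eq_one_of_normSq (by rw [Quaternion.normSq_def', qi]; norm_num)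

theorem norm_qj : ‖qj‖ = 1 :=
  norm_eq_one_of_normSq (by rw [Quaternion.normSq_def', qj]; norm_num)

theorem expI_eq (θ : ℝ) : expI θ = Real.cos θ • (1 : ℍ) + Real.sin θ • qi :=
  exp_smul_imaginary rfl norm_qi θ

theorem expJ_eq (θ : ℝ) : expJ θ = Real.cos θ • (1 : ℍ) + Real.sin θ • qj :=
  exp_smul_imaginary rfl norm_qj θ

theorem continuous_expI : Continuous expI := by
  have : expI = fun θ => Real.cos θ • (1 : ℍ) + Real.sin θ • qi := funext expI_eq
  rw [this]
  fun_prop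

theorem continuous_expJ : Continuous expJ := by
  have : expJ = fun θ => Real.cos θ • (1 : ℍ) + Real.sin θ • qj := funext expJ_eq
  rw [this]
  fun_prop

theorem norm_expI (θ : ℝ) : ‖expI θ‖ = 1 := by
  rw [expI, Quaternion.norm_exp, Quaternion.re_smul, show qi.re = 0 from rfl, smul_zero]
  simp

theorem norm_expJ (θ : ℝ) : ‖expJ θ‖ = 1 := by
  rw [expJ, Quaternion.norm_exp, Quaternion.re_smul, show qj.re = 0 from rfl, smul_zero]
  simp

theorem expI_add (a b : ℝ) : expI (a + b) = expI a * expI b := by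
  rw [expI, expI, expI, add_smul]
  let : NormedAlgebra ℚ ℍ := NormedAlgebra.restrictScalars ℚ ℝ ℍ
  exact NormedSpace.exp_add_of_commute (Commute.smul_left (Commute.smul_right rfl _) _)

theorem expJ_add (a b : ℝ) : expJ (a + b) = expJ a * expJ b := by
  rw [expJ, expJ, expJ, add_smul]
  let : NormedAlgebra ℚ ℍ := NormedAlgebra.restrictScalars ℚ ℝ ℍ
  exact NormedSpace.exp_add_of_commute (Commute.smul_left (Commute.smul_right rfl _) _)

/-- The sine part is odd and drops out. What remains is real, hence commutes with every quaternion.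
-/
theorem integral_cos_smul_add_sin_smul (q : ℍ) (N c : ℝ) :
    ∫ v in (-N)..N, (Real.cos (v * c) • (1 : ℍ) + Real.sin (v * c) • q) =
      (2 * dirichletKer N c) • (1 : ℍ) := by
  have hc : ∫ v in (-N)..N, Real.cos (v * c) = 2 * dirichletKer N c := by
    rcases eq_or_ne c 0 with rfl | h
    · simp [dirichletKer]; ring
    · rw [intervalIntegral.integral_comp_mul_right _ h, integral_cos, dirichletKer_of_ne_zero N h,
        neg_mul, Real.sin_neg, smul_eq_mul]
      ring
  have hs : ∫ v in (-N)..N, Real.sin (v * c) = 0 := by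
    rcases eq_or_ne c 0 with rfl | h
    · simp
    · rw [intervalIntegral.integral_comp_mul_right _ h, integral_sin, neg_mul, Real.cos_neg,
        sub_self, smul_zero]
  rw [intervalIntegral.integral_add (Continuous.intervalIntegrable (by fun_prop) _ _)
    (Continuous.intervalIntegrable (by fun_prop) _ _), intervalIntegral.integral_smul_const,
    intervalIntegral.integral_smul_const, hc, hs, zero_smul, add_zero]

theorem integral_expI (N c : ℝ) :
    ∫ v in (-N)..N, expI (v * c) = (2 * dirichletKer N c) • (1 : ℍ) := by
  simp_rw [expI_eq]
  exact integral_cos_smul_add_sin_smul qi N c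

theorem integral_expJ (N c : ℝ) :
    ∫ v in (-N)..N, expJ (v * c) = (2 * dirichletKer N c) • (1 : ℍ) := by
  simp_rw [expJ_eq]
  exact integral_cos_smul_add_sin_smul qj N c

/-- Moving the innermost of three integrals outwards. -/
theorem integral_integral_integral_rotate {α β γ E : Type*} [MeasurableSpace α]
    [MeasurableSpace β] [MeasurableSpace γ] [NormedAddCommGroup E] [NormedSpace ℝ E]
    {μ : Measure α} {ν : Measure β} {κ : Measure γ} [SFinite μ] [SFinite ν] [SFinite κ]
    {F : α → β → γ → E}
    (hF : Integrable (fun x : (α × β) × γ => F x.1.1 x.1.2 x.2) ((μ.prod ν).prod κ)) :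
    (∫ a, ∫ b, ∫ c, F a b c ∂κ ∂ν ∂μ) = (∫ c, ∫ a, ∫ b, F a b c ∂ν ∂μ ∂κ) ∧
      (∫ a, ∫ b, ∫ c, F a b c ∂κ ∂ν ∂μ) = ∫ c, ∫ b, ∫ a, F a b c ∂μ ∂ν ∂κ := by
  have h1 : ∫ a, ∫ b, ∫ c, F a b c ∂κ ∂ν ∂μ = ∫ c, ∫ x, F x.1 x.2 c ∂(μ.prod ν) ∂κ := by
    have h2 := integral_prod (fun x : α × β => ∫ c, F x.1 x.2 c ∂κ) hF.integral_prod_left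
    rw [← h2]
    exact integral_integral_swap (f := fun (x : α × β) c => F x.1 x.2 c) hF
  have h3 := hF.prod_left_ae
  refine ⟨h1.trans (integral_congr_ae ?_), h1.trans (integral_congr_ae ?_)⟩
  · filter_upwards [h3] with c hc
    exact integral_prod _ hc
  · filter_upwards [h3] with c hc
    exact integral_prod_symm _ hc

/-- The double Dirichlet integral of `f` at `(x₀, y₀)`. -/
noncomputable def dirichletIntegral (f : ℝ × ℝ → ℍ) (x₀ y₀ N M : ℝ) : ℍ :=
  (1 / Real.pi ^ 2) • ∫ p : ℝ × ℝ, (dirichletKer M (x₀ - p.1) * dirichletKer N (y₀ - p.2)) • f p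

section Inversion

variable {f : ℝ × ℝ → ℍ}

/-- In e^{-ius} e^{-jvt} e^{jvy₀} e^{iux₀} the `j`-factors are adjacent, so `v` is integrated first;
the result is real, and the `i`-factors meet. Signs of `N` and `M` let interval integrals be read as
set integrals. -/
theorem rightInversion_eq (hf : Integrable f) (x₀ y₀ : ℝ) {N M : ℝ} (hN : 0 ≤ N) (hM : 0 ≤ M) :
    rightInversion f x₀ y₀ N M = dirichletIntegral f x₀ y₀ N M := by
  have hN' : -N ≤ N := by linarith
  have hM' : -M ≤ M := by linarith
  have hcI := continuous_expI
  have hcJ := continuous_expJ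
  have h1 : ∀ u v : ℝ, rightQFT f u v * expJ (v * y₀) * expI (u * x₀) =
      ∫ p : ℝ × ℝ, f p * (expI (-(u * p.1)) * expJ (v * (y₀ - p.2)) * expI (u * x₀)) := by
    intro u v
    have hi : Integrable (fun p : ℝ × ℝ => f p * expI (-(u * p.1)) * expJ (-(v * p.2))) := by
      refine (hf.mul_bdd (c := 1) ?_ (ae_of_all _ fun p => (norm_expI _).le)).mul_bdd (c := 1) ?_
        (ae_of_all _ fun p => (norm_expJ _).le)
      · exact Continuous.aestronglyMeasurable (by fun_prop)
      · exact Continuous.aestronglyMeasurable (by fun_prop)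
    rw [rightQFT, mul_assoc, ← integral_mul_const_of_integrable hi]
    refine integral_congr_ae (ae_of_all _ fun p => ?_)
    have : v * (y₀ - p.2) = -(v * p.2) + v * y₀ := by ring
    simp only [this, expJ_add, mul_assoc]
  -- The exponentials have norm 1 and the box of frequencies is bounded, so integrability of `f`
  -- justifies Fubini.
  have h2 : Integrable (fun x : (ℝ × ℝ) × (ℝ × ℝ) => f x.2 *
      (expI (-(x.1.2 * x.2.1)) * expJ (x.1.1 * (y₀ - x.2.2)) * expI (x.1.2 * x₀)))
      (((volume.restrict (Ioc (-N) N)).prod (volume.restrict (Ioc (-M) M))).prod volume) := by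
    refine (Integrable.comp_snd hf _).mul_bdd (c := 1) ?_ (ae_of_all _ fun x => ?_)
    · exact Continuous.aestronglyMeasurable (by fun_prop)
    · simp only [norm_mul, norm_expI, norm_expJ, mul_one, le_refl]
  have h3 : ∀ p : ℝ × ℝ, ∫ u in (-M)..M, ∫ v in (-N)..N,
      f p * (expI (-(u * p.1)) * expJ (v * (y₀ - p.2)) * expI (u * x₀)) =
      (4 * (dirichletKer M (x₀ - p.1) * dirichletKer N (y₀ - p.2))) • f p := by
    intro p
    have hv : ∀ u, ∫ v in (-N)..N,
        f p * (expI (-(u * p.1)) * expJ (v * (y₀ - p.2)) * expI (u * x₀)) =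
        (2 * dirichletKer N (y₀ - p.2)) • (f p * expI (u * (x₀ - p.1))) := by
      intro u
      have hJ : IntegrableOn (fun v => expJ (v * (y₀ - p.2))) (Ioc (-N) N) :=
        ((Continuous.integrableOn_Icc (by fun_prop))).mono_set Ioc_subset_Icc_self
      simp only [← mul_assoc]
      rw [intervalIntegral.integral_of_le hN', integral_mul_const_of_integrable (hJ.const_mul _),
        integral_const_mul_of_integrable hJ, ← intervalIntegral.integral_of_le hN', integral_expJ]
      have : u * (x₀ - p.1) = -(u * p.1) + u * x₀ := by ring
      rw [this, expI_add, mul_smul_comm, mul_one, smul_mul_assoc, mul_assoc]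
    simp_rw [hv]
    have hI : IntegrableOn (fun u => expI (u * (x₀ - p.1))) (Ioc (-M) M) :=
      ((Continuous.integrableOn_Icc (by fun_prop))).mono_set Ioc_subset_Icc_self
    rw [intervalIntegral.integral_smul, intervalIntegral.integral_of_le hM',
      integral_const_mul_of_integrable hI, ← intervalIntegral.integral_of_le hM', integral_expI,
      mul_smul_comm, mul_one, smul_smul]
    congr 1
    ring
  have h4 := (integral_integral_integral_rotate (F := fun v u p => f p *
      (expI (-(u * p.1)) * expJ (v * (y₀ - p.2)) * expI (u * x₀))) h2).2
  simp only [← intervalIntegral.integral_of_le hN', ← intervalIntegral.integral_of_le hM', h3] at h4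
  rw [rightInversion, dirichletIntegral]
  simp_rw [h1]
  rw [h4]
  simp_rw [mul_smul (4 : ℝ)]
  rw [integral_smul, smul_smul]
  congr 1
  field_simp

/-- Here the `i`-factors are adjacent, in e^{jvy₀} e^{iux₀} e^{-ius} e^{-jvt}, so `u` is integrated
first. -/
theorem leftInversion_eq (hf : Integrable f) (x₀ y₀ : ℝ) {N M : ℝ} (hN : 0 ≤ N) (hM : 0 ≤ M) :
    leftInversion f x₀ y₀ N M = dirichletIntegral f x₀ y₀ N M := by
  have hN' : -N ≤ N := by linarith
  have hM' : -M ≤ M := by linarith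
  have hcI := continuous_expI
  have hcJ := continuous_expJ
  have h1 : ∀ u v : ℝ, expJ (v * y₀) * expI (u * x₀) * leftQFT f u v =
      ∫ p : ℝ × ℝ, expJ (v * y₀) * expI (u * (x₀ - p.1)) * expJ (-(v * p.2)) * f p := by
    intro u v
    have hi : Integrable (fun p : ℝ × ℝ => expI (-(u * p.1)) * expJ (-(v * p.2)) * f p) := by
      refine hf.bdd_mul (c := 1) ?_ (ae_of_all _ fun p => ?_)
      · exact Continuous.aestronglyMeasurable (by fun_prop)
      · simp only [norm_mul, norm_expI, norm_expJ, mul_one, le_refl]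
    rw [leftQFT, ← integral_const_mul_of_integrable hi]
    refine integral_congr_ae (ae_of_all _ fun p => ?_)
    have : u * (x₀ - p.1) = u * x₀ + -(u * p.1) := by ring
    simp only [this, expI_add, mul_assoc]
  have h2 : Integrable (fun x : (ℝ × ℝ) × (ℝ × ℝ) =>
      expJ (x.1.1 * y₀) * expI (x.1.2 * (x₀ - x.2.1)) * expJ (-(x.1.1 * x.2.2)) * f x.2)
      (((volume.restrict (Ioc (-N) N)).prod (volume.restrict (Ioc (-M) M))).prod volume) := by
    refine (Integrable.comp_snd hf _).bdd_mul (c := 1) ?_ (ae_of_all _ fun x => ?_)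
    · exact Continuous.aestronglyMeasurable (by fun_prop)
    · simp only [norm_mul, norm_expI, norm_expJ, mul_one, le_refl]
  have h3 : ∀ p : ℝ × ℝ, ∫ v in (-N)..N, ∫ u in (-M)..M,
      expJ (v * y₀) * expI (u * (x₀ - p.1)) * expJ (-(v * p.2)) * f p =
      (4 * (dirichletKer M (x₀ - p.1) * dirichletKer N (y₀ - p.2))) • f p := by
    intro p
    have hu : ∀ v, ∫ u in (-M)..M,
        expJ (v * y₀) * expI (u * (x₀ - p.1)) * expJ (-(v * p.2)) * f p =
        (2 * dirichletKer M (x₀ - p.1)) • (expJ (v * (y₀ - p.2)) * f p) := by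
      intro v
      have hI : IntegrableOn (fun u => expI (u * (x₀ - p.1))) (Ioc (-M) M) :=
        ((Continuous.integrableOn_Icc (by fun_prop))).mono_set Ioc_subset_Icc_self
      rw [intervalIntegral.integral_of_le hM',
        integral_mul_const_of_integrable ((hI.const_mul _).mul_const _),
        integral_mul_const_of_integrable (hI.const_mul _),
        integral_const_mul_of_integrable hI, ← intervalIntegral.integral_of_le hM', integral_expI]
      have : v * (y₀ - p.2) = v * y₀ + -(v * p.2) := by ring
      rw [this, expJ_add, mul_smul_comm, mul_one, smul_mul_assoc, smul_mul_assoc]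
    simp_rw [hu]
    have hJ : IntegrableOn (fun v => expJ (v * (y₀ - p.2))) (Ioc (-N) N) :=
      ((Continuous.integrableOn_Icc (by fun_prop))).mono_set Ioc_subset_Icc_self
    rw [intervalIntegral.integral_smul, intervalIntegral.integral_of_le hN',
      integral_mul_const_of_integrable hJ, ← intervalIntegral.integral_of_le hN', integral_expJ,
      smul_mul_assoc, one_mul, smul_smul]
    congr 1
    ring
  have h4 := (integral_integral_integral_rotate (F := fun v u p =>
      expJ (v * y₀) * expI (u * (x₀ - p.1)) * expJ (-(v * p.2)) * f p) h2).1
  simp only [← intervalIntegral.integral_of_le hN', ← intervalIntegral.integral_of_le hM', h3] at h4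
  rw [leftInversion, dirichletIntegral]
  simp_rw [h1]
  rw [h4]
  simp_rw [mul_smul (4 : ℝ)]
  rw [integral_smul, smul_smul]
  congr 1
  field_simp

end Inversion

/-! ### Passage to components and conclusion. -/

theorem abs_re_le_norm (q : ℍ) : |q.re| ≤ ‖q‖ := by
  refine abs_le_of_sq_le_sq ?_ (norm_nonneg q)
  rw [sq ‖q‖, ← Quaternion.normSq_eq_norm_mul_self, Quaternion.normSq_def']
  nlinarith [sq_nonneg q.imI, sq_nonneg q.imJ, sq_nonneg q.imK]

theorem abs_imI_le_norm (q : ℍ) : |q.imI| ≤ ‖q‖ := by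
  refine abs_le_of_sq_le_sq ?_ (norm_nonneg q)
  rw [sq ‖q‖, ← Quaternion.normSq_eq_norm_mul_self, Quaternion.normSq_def']
  nlinarith [sq_nonneg q.re, sq_nonneg q.imJ, sq_nonneg q.imK]

theorem abs_imJ_le_norm (q : ℍ) : |q.imJ| ≤ ‖q‖ := by
  refine abs_le_of_sq_le_sq ?_ (norm_nonneg q)
  rw [sq ‖q‖, ← Quaternion.normSq_eq_norm_mul_self, Quaternion.normSq_def']
  nlinarith [sq_nonneg q.re, sq_nonneg q.imI, sq_nonneg q.imK]

theorem abs_imK_le_norm (q : ℍ) : |q.imK| ≤ ‖q‖ := by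
  refine abs_le_of_sq_le_sq ?_ (norm_nonneg q)
  rw [sq ‖q‖, ← Quaternion.normSq_eq_norm_mul_self, Quaternion.normSq_def']
  nlinarith [sq_nonneg q.re, sq_nonneg q.imI, sq_nonneg q.imJ]

/-- The real part, as a continuous linear functional. -/
noncomputable def reCLM : ℍ →L[ℝ] ℝ :=
  ⟨⟨⟨fun q => q.re, fun _ _ => by simp⟩, fun _ _ => by simp⟩, Quaternion.continuous_re⟩

/-- The `i`-component, as a continuous linear functional. -/
noncomputable def imICLM : ℍ →L[ℝ] ℝ :=
  ⟨⟨⟨fun q => q.imI, fun _ _ => by simp⟩, fun _ _ => by simp⟩, Quaternion.continuous_imI⟩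

/-- The `j`-component, as a continuous linear functional. -/
noncomputable def imJCLM : ℍ →L[ℝ] ℝ :=
  ⟨⟨⟨fun q => q.imJ, fun _ _ => by simp⟩, fun _ _ => by simp⟩, Quaternion.continuous_imJ⟩

/-- The `k`-component, as a continuous linear functional. -/
noncomputable def imKCLM : ℍ →L[ℝ] ℝ :=
  ⟨⟨⟨fun q => q.imK, fun _ _ => by simp⟩, fun _ _ => by simp⟩, Quaternion.continuous_imK⟩

theorem quaternion_eq_components (q : ℍ) :
    q = ((q.re : ℝ) : ℍ) + q.imI • qi + q.imJ • qj + q.imK • qk := by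
  have hi : qi.re = 0 ∧ qi.imI = 1 ∧ qi.imJ = 0 ∧ qi.imK = 0 := ⟨rfl, rfl, rfl, rfl⟩
  have hj : qj.re = 0 ∧ qj.imI = 0 ∧ qj.imJ = 1 ∧ qj.imK = 0 := ⟨rfl, rfl, rfl, rfl⟩
  have hk : qk.re = 0 ∧ qk.imI = 0 ∧ qk.imJ = 0 ∧ qk.imK = 1 := ⟨rfl, rfl, rfl, rfl⟩
  ext <;> simp [hi, hj, hk]

theorem tendsto_of_components {ι : Type*} {l : Filter ι} {F : ι → ℍ} {a b c d : ℝ}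
    (ha : Tendsto (fun i => (F i).re) l (𝓝 a)) (hb : Tendsto (fun i => (F i).imI) l (𝓝 b))
    (hc : Tendsto (fun i => (F i).imJ) l (𝓝 c)) (hd : Tendsto (fun i => (F i).imK) l (𝓝 d)) :
    Tendsto F l (𝓝 ((a : ℍ) + b • qi + c • qj + d • qk)) := by
  have h := ((((Quaternion.continuous_coe.tendsto a).comp ha).add (hb.smul_const qi)).add
    (hc.smul_const qj)).add (hd.smul_const qk)
  exact h.congr fun i => (quaternion_eq_components (F i)).symm

variable {f : ℝ × ℝ → ℍ} {x₀ y₀ ε₁ ε₂ : ℝ}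

/-- Convergence of the double Dirichlet integral of a component of `f`. -/
theorem tendsto_component_dirichletIntegral (hf : Integrable f) (hε₁ : 0 < ε₁) (hε₂ : 0 < ε₂)
    (hLC : IsLC f x₀ y₀ ε₁ ε₂) (T : ℍ →L[ℝ] ℝ) (hT : ∀ q, |T q| ≤ ‖q‖)
    (hBV : IsBVFIn (fun p => T (f p)) (crossNeighborhood x₀ y₀ ε₁ ε₂)) :
    QuadrantLimitsExist (fun p => T (f p)) x₀ y₀ ∧
      Tendsto (fun q : ℝ × ℝ => T (dirichletIntegral f x₀ y₀ q.1 q.2)) (atTop ×ˢ atTop)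
        (𝓝 (eta (fun p => T (f p)) x₀ y₀)) := by
  obtain ⟨⟨a, ha, hLa⟩, ⟨b, hb, hLb⟩⟩ := hLC
  have hTe : ∀ q, ‖T q‖ₑ ≤ ‖q‖ₑ := fun q => enorm_le_iff_norm_le.2 (hT q)
  obtain ⟨h1, h2⟩ := quadrantLimitsExist_and_tendsto_integral (g := fun p => T (f p)) hε₁ hε₂
    (T.integrable_comp hf) hBV (T.integrable_comp ha) (T.integrable_comp hb)
    (by
      -- `T` commutes with the symmetrisation and does not increase norms, so LC passes to the
      -- component.
      refine lt_of_le_of_lt (lintegral_mono fun t => lintegral_mono fun s => ?_) hLa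
      refine le_trans (le_of_eq ?_) (hTe _)
      simp [symm])
    (by
      refine lt_of_le_of_lt (lintegral_mono fun s => lintegral_mono fun t => ?_) hLb
      refine le_trans (le_of_eq ?_) (hTe _)
      simp [symm])
  refine ⟨h1, h2.congr fun q => ?_⟩
  have hi : Integrable (fun p : ℝ × ℝ =>
      (dirichletKer q.2 (x₀ - p.1) * dirichletKer q.1 (y₀ - p.2)) • f p) := by
    refine hf.bdd_smul (φ := fun p : ℝ × ℝ =>
      dirichletKer q.2 (x₀ - p.1) * dirichletKer q.1 (y₀ - p.2)) (|q.2| * |q.1|) ?_ (ae_of_all _ fun p => ?_)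
    · have hM := continuous_dirichletKer q.2
      have hN := continuous_dirichletKer q.1
      exact Continuous.aestronglyMeasurable (by fun_prop)
    · rw [norm_mul]
      exact mul_le_mul (abs_dirichletKer_le _ _) (abs_dirichletKer_le _ _) (norm_nonneg _)
        (abs_nonneg _)
  rw [dirichletIntegral, map_smul, smul_eq_mul, ← T.integral_comp_comm hi]
  simp only [map_smul, smul_eq_mul]
  congr 2
  funext p
  ring

theorem eta_eq_of_continuousAt {E : Type*} [NormedAddCommGroup E] [NormedSpace ℝ E]
    {f : ℝ × ℝ → E} (h : ContinuousAt f (x₀, y₀)) : eta f x₀ y₀ = f (x₀, y₀) := by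
  have hq : ∀ s t : Set ℝ, Tendsto f (𝓝[s] x₀ ×ˢ 𝓝[t] y₀) (𝓝 (f (x₀, y₀))) := fun s t => by
    refine Tendsto.mono_left h ?_
    rw [nhds_prod_eq]
    exact Filter.prod_mono nhdsWithin_le_nhds nhdsWithin_le_nhds
  rw [eta_eq_of_tendsto (hq _ _) (hq _ _) (hq _ _) (hq _ _)]
  module

end QFT

theorem mainTheorem3 (f : ℝ × ℝ → ℍ) (hf : Integrable f) (x₀ y₀ ε₁ ε₂ : ℝ)
    (hε₁ : 0 < ε₁) (hε₂ : 0 < ε₂)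
    (hBV : QFT.IsQBVFIn f (QFT.crossNeighborhood x₀ y₀ ε₁ ε₂))
    (hLC : QFT.IsLC f x₀ y₀ ε₁ ε₂) :
    QFT.QuadrantLimitsExist f x₀ y₀ ∧
    Tendsto (fun p : ℝ × ℝ => QFT.rightInversion f x₀ y₀ p.1 p.2)
      (atTop ×ˢ atTop) (𝓝 (QFT.eta f x₀ y₀)) ∧
    Tendsto (fun p : ℝ × ℝ => QFT.leftInversion f x₀ y₀ p.1 p.2)
      (atTop ×ˢ atTop) (𝓝 (QFT.eta f x₀ y₀)) ∧
    (QFT.QuadrantLimitsExist (fun p => (f p).re) x₀ y₀ ∧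
      QFT.QuadrantLimitsExist (fun p => (f p).imI) x₀ y₀ ∧
      QFT.QuadrantLimitsExist (fun p => (f p).imJ) x₀ y₀ ∧
      QFT.QuadrantLimitsExist (fun p => (f p).imK) x₀ y₀ ∧
      QFT.eta f x₀ y₀ =
        ((QFT.eta (fun p => (f p).re) x₀ y₀ : ℝ) : ℍ) +
          QFT.eta (fun p => (f p).imI) x₀ y₀ • QFT.qi +
          QFT.eta (fun p => (f p).imJ) x₀ y₀ • QFT.qj +
          QFT.eta (fun p => (f p).imK) x₀ y₀ • QFT.qk) ∧
    (ContinuousAt f (x₀, y₀) → QFT.eta f x₀ y₀ = f (x₀, y₀)) := by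
  obtain ⟨q₀, t₀⟩ := QFT.tendsto_component_dirichletIntegral hf hε₁ hε₂ hLC QFT.reCLM
    QFT.abs_re_le_norm hBV.re
  obtain ⟨q₁, t₁⟩ := QFT.tendsto_component_dirichletIntegral hf hε₁ hε₂ hLC QFT.imICLM
    QFT.abs_imI_le_norm hBV.imI
  obtain ⟨q₂, t₂⟩ := QFT.tendsto_component_dirichletIntegral hf hε₁ hε₂ hLC QFT.imJCLM
    QFT.abs_imJ_le_norm hBV.imJ
  obtain ⟨q₃, t₃⟩ := QFT.tendsto_component_dirichletIntegral hf hε₁ hε₂ hLC QFT.imKCLM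
    QFT.abs_imK_le_norm hBV.imK
  change QFT.QuadrantLimitsExist (fun p => (f p).re) x₀ y₀ at q₀
  change QFT.QuadrantLimitsExist (fun p => (f p).imI) x₀ y₀ at q₁
  change QFT.QuadrantLimitsExist (fun p => (f p).imJ) x₀ y₀ at q₂
  change QFT.QuadrantLimitsExist (fun p => (f p).imK) x₀ y₀ at q₃
  obtain ⟨⟨a₀, ha₀⟩, ⟨b₀, hb₀⟩, ⟨c₀, hc₀⟩, ⟨d₀, hd₀⟩⟩ := id q₀
  obtain ⟨⟨a₁, ha₁⟩, ⟨b₁, hb₁⟩, ⟨c₁, hc₁⟩, ⟨d₁, hd₁⟩⟩ := id q₁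
  obtain ⟨⟨a₂, ha₂⟩, ⟨b₂, hb₂⟩, ⟨c₂, hc₂⟩, ⟨d₂, hd₂⟩⟩ := id q₂
  obtain ⟨⟨a₃, ha₃⟩, ⟨b₃, hb₃⟩, ⟨c₃, hc₃⟩, ⟨d₃, hd₃⟩⟩ := id q₃
  have ha := QFT.tendsto_of_components ha₀ ha₁ ha₂ ha₃
  have hb := QFT.tendsto_of_components hb₀ hb₁ hb₂ hb₃
  have hc := QFT.tendsto_of_components hc₀ hc₁ hc₂ hc₃
  have hd := QFT.tendsto_of_components hd₀ hd₁ hd₂ hd₃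
  have heta : QFT.eta f x₀ y₀ =
        ((QFT.eta (fun p => (f p).re) x₀ y₀ : ℝ) : ℍ) +
          QFT.eta (fun p => (f p).imI) x₀ y₀ • QFT.qi +
          QFT.eta (fun p => (f p).imJ) x₀ y₀ • QFT.qj +
          QFT.eta (fun p => (f p).imK) x₀ y₀ • QFT.qk := by
    rw [QFT.eta_eq_of_tendsto ha hb hc hd, QFT.eta_eq_of_tendsto ha₀ hb₀ hc₀ hd₀,
      QFT.eta_eq_of_tendsto ha₁ hb₁ hc₁ hd₁, QFT.eta_eq_of_tendsto ha₂ hb₂ hc₂ hd₂,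
      QFT.eta_eq_of_tendsto ha₃ hb₃ hc₃ hd₃]
    have hcoe : ∀ r : ℝ, (r : ℍ) = r • (1 : ℍ) := fun r => by ext <;> simp
    simp only [hcoe, smul_eq_mul]
    module
  have hmain : Tendsto (fun p : ℝ × ℝ => QFT.dirichletIntegral f x₀ y₀ p.1 p.2)
      (atTop ×ˢ atTop) (𝓝 (QFT.eta f x₀ y₀)) := by
    rw [heta]
    exact QFT.tendsto_of_components t₀ t₁ t₂ t₃
  -- The inversion integrals were identified with the Dirichlet integral for nonnegative bounds
  -- only.
  have hpos : ∀ᶠ p : ℝ × ℝ in atTop ×ˢ atTop, 0 ≤ p.1 ∧ 0 ≤ p.2 :=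
    (tendsto_fst.eventually (eventually_ge_atTop 0)).and
      (tendsto_snd.eventually (eventually_ge_atTop 0))
  refine ⟨⟨⟨_, ha⟩, ⟨_, hb⟩, ⟨_, hc⟩, ⟨_, hd⟩⟩, hmain.congr' ?_, hmain.congr' ?_,
    ⟨q₀, q₁, q₂, q₃, heta⟩, QFT.eta_eq_of_continuousAt⟩
  · filter_upwards [hpos] with p hp
    exact (QFT.rightInversion_eq hf x₀ y₀ hp.1 hp.2).symm
  · filter_upwards [hpos] with p hp
    exact (QFT.leftInversion_eq hf x₀ y₀ hp.1 hp.2).symm
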